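/- \textbf{Theorem 3.} Let $\alpha>0$. There is a constant $C$ depending only on $\alpha$ such that the following holds. Let $D>0$ and let $b:\mathbb{R}^3\times\mathbb{S}^2\to\mathbb{C}$ be a symbol with $$\|b(\cdot,\omega)\|_{H^{3/2}(\mathbb{R}^3)}+\|\nabla b(\cdot,\omega)\|_{L^\infty_{x\cdot\omega}L^2}+\|\nabla\!\!\!\!/\,\nabla b(\cdot,\omega)\|_{L^2(\mathbb{R}^3)}+\|\partial_\omega b(\cdot,\omega)\|_{H^{1/2+\alpha}(\mathbb{R}^3)}\le D$$ uniformly in $\omega\in\mathbb{S}^2$. Here all derivatives are weak derivatives, $\nabla$ is the gradient in $x$, $\nabla\!\!\!\!/$ denotes the derivatives in $x$ in the directions orthogonal to $\omega$, $\partial_\omega$ is the gradient on the sphere, and $\|F\|_{L^\infty_{x\cdot\omega}L^2}=\operatorname{ess\,sup}_{u\in\mathbb{R}}\|F\|_{L^2(P_u)}$ with $P_u=\{x\in\mathbb{R}^3 : x\cdot\omega=u\}$. Then the pseudodifferential operator with symbol $b$, $$Bf(x)=\int_{\mathbb{S}^2}\int_0^{+\infty}e^{i\lambda x\cdot\omega}\,b(x,\omega)\,\mathcal{F}f(\lambda\omega)\,\lambda^2\,d\lambda\,d\omega,$$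 where $\mathcal{F}f(\xi)=\int_{\mathbb{R}^3} e^{-ix\cdot\xi}f(x)\,dx$ is the Fourier transform, is bounded on $L^2(\mathbb{R}^3)$: the integral converges absolutely for almost every $x$ when $f\in L^2(\mathbb{R}^3)$ has $\mathcal{F}f\in L^1(\mathbb{R}^3)$, and $B$ extends to a bounded linear operator on $L^2(\mathbb{R}^3)$ which, for every $f\in L^2(\mathbb{R}^3)$, is given by the integral at almost every $x$ at which the integral converges absolutely, and which satisfies $$\|Bf\|_{L^2(\mathbb{R}^3)}\le C\,D\,\|f\|_{L^2(\mathbb{R}^3)}\qquad\text{for all } f\in L^2(\mathbb{R}^3).$$ -/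

import Mathlib

open MeasureTheory Set Metric
open scoped ENNReal FourierTransform

noncomputable section

/-- Euclidean space `ℝ³`. -/
abbrev E3 : Type := EuclideanSpace ℝ (Fin 3)

/-- The unit sphere `𝕊²` of `ℝ³`. -/
abbrev S2 : Type := sphere (0 : E3) 1

/-- The surface measure of `𝕊²` (of total mass `4π`). -/
abbrev surfS2 : Measure S2 := (volume : Measure E3).toSphere

/-- The Hilbert space `L²(ℝ³; ℂ)`. -/
abbrev L2E3 : Type := Lp ℂ 2 (volume : Measure E3)

/-- The `i`-th vector of the standard basis of `ℝ³`. -/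
def stdVec (i : Fin 3) : E3 := EuclideanSpace.single i (1 : ℝ)

/-- The Sobolev norm of `H^s(ℝ³)`, `s ≥ 0`: `(∫ (1 + |η|²)^s |f̂(η)|² dη)^{1/2}` up to the
normalization of the Fourier transform, and `∞` when `f` is not in `L²`. Since `𝓕` here has kernel
`e^{-2πi x·ξ}`, the frequency variable is `η = 2πξ`. -/
def sobolevNorm {F : Type*} [NormedAddCommGroup F] [InnerProductSpace ℂ F] [CompleteSpace F]
    (s : ℝ) (f : E3 → F) : ℝ≥0∞ :=
  open Classical in
  if h : MemLp f 2 (volume : Measure E3) then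
    (∫⁻ ξ : E3, ENNReal.ofReal ((1 + (2 * Real.pi * ‖ξ‖) ^ 2) ^ s) *
      ‖(𝓕 (h.toLp f) : Lp F 2 (volume : Measure E3)) ξ‖ₑ ^ 2) ^ (1 / 2 : ℝ)
  else ⊤

/-- The norm of `L^∞_{x·ω} L²`: the essential supremum over `u ∈ ℝ` of the `L²` norm on the plane
`P_u = {x | x·ω = u} = uω + ω^⊥` for its area measure. -/
def planeSupNorm {F : Type*} [NormedAddCommGroup F] (ω : S2) (G : E3 → F) : ℝ≥0∞ :=
  essSup (fun u : ℝ =>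
    eLpNorm (fun y : ((Submodule.span ℝ {(ω : E3)})ᗮ : Submodule ℝ E3) =>
      G (u • (ω : E3) + (y : E3))) 2 volume) volume

/-- `g` is the weak derivative of `f` on `ℝ³` in the direction `v`. -/
def HasWeakDirDeriv (v : E3) (f g : E3 → ℂ) : Prop :=
  LocallyIntegrable f ∧ LocallyIntegrable g ∧
    ∀ φ : E3 → ℝ, ContDiff ℝ (⊤ : ℕ∞) φ → HasCompactSupport φ →
      ∫ x, (fderiv ℝ φ x v) • f x = - ∫ x, φ x • g x

/-- `G = ∇f` weakly. -/
def HasWeakGradient (f : E3 → ℂ) (G : E3 → EuclideanSpace ℂ (Fin 3)) : Prop :=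
  ∀ i, HasWeakDirDeriv (stdVec i) f (fun x => G x i)

/-- `H = ∇̸ G` weakly, where `∇̸` is differentiation in the directions orthogonal to `ω`: the entry
`H (i, j)` is the derivative of `G j` along `e_i - ω_i ω`, the orthogonal projection of `e_i` to
the plane `ω^⊥`. -/
def HasWeakTangentialGradient (ω : S2) (G : E3 → EuclideanSpace ℂ (Fin 3))
    (H : E3 → EuclideanSpace ℂ (Fin 3 × Fin 3)) : Prop :=
  ∀ i j, HasWeakDirDeriv (stdVec i - (ω : E3) i • (ω : E3)) (fun x => G x j) (fun x => H x (i, j))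

/-- `W = ∂_ω b` weakly: for almost every `(x, ω)` the vector `W x ω` is tangent to `𝕊²` at `ω`,
and its pairing with each rotation field `ω_i e_j - ω_j e_i` (these span the tangent space at every
point and are divergence free on `𝕊²`) is the weak derivative of `b` along that field. -/
def HasWeakAngularGradient (b : E3 → S2 → ℂ) (W : E3 → S2 → EuclideanSpace ℂ (Fin 3)) : Prop :=
  LocallyIntegrable (Function.uncurry b) ((volume : Measure E3).prod surfS2) ∧
  LocallyIntegrable (Function.uncurry W) ((volume : Measure E3).prod surfS2) ∧
  (∀ᵐ p ∂((volume : Measure E3).prod surfS2),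
    ∑ i : Fin 3, (((p.2 : E3) i : ℝ) : ℂ) * W p.1 p.2 i = 0) ∧
  ∀ φ : E3 × E3 → ℝ, ContDiff ℝ (⊤ : ℕ∞) φ → HasCompactSupport φ → ∀ i j : Fin 3,
    ∫ p : E3 × S2,
        (fderiv ℝ φ (p.1, (p.2 : E3))
          ((0 : E3), (p.2 : E3) i • stdVec j - (p.2 : E3) j • stdVec i)) • b p.1 p.2
        ∂((volume : Measure E3).prod surfS2) =
      - ∫ p : E3 × S2,
        φ (p.1, (p.2 : E3)) • ((p.2 : E3) i • W p.1 p.2 j - (p.2 : E3) j • W p.1 p.2 i)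
        ∂((volume : Measure E3).prod surfS2)

/-- The symbol bound
`‖b‖_{H^{3/2}} + ‖∇b‖_{L^∞_{x·ω} L²} + ‖∇̸∇b‖_{L²} + ‖∂_ω b‖_{H^{1/2+α}} ≤ D`,
where the norms are taken in `x ∈ ℝ³` for fixed `ω`, uniformly in (almost every) `ω ∈ 𝕊²`. -/
def SymbolBound (α D : ℝ) (b : E3 → S2 → ℂ) : Prop :=
  ∃ W : E3 → S2 → EuclideanSpace ℂ (Fin 3), HasWeakAngularGradient b W ∧
    ∀ᵐ ω ∂surfS2, ∃ (G : E3 → EuclideanSpace ℂ (Fin 3)) (H : E3 → EuclideanSpace ℂ (Fin 3 × Fin 3)),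
      HasWeakGradient (fun x => b x ω) G ∧ HasWeakTangentialGradient ω G H ∧
      sobolevNorm (3 / 2) (fun x => b x ω) + planeSupNorm ω G + eLpNorm H 2 volume +
        sobolevNorm (1 / 2 + α) (fun x => W x ω) ≤ ENNReal.ofReal D

/-- The Fourier transform `ℱf(ξ) = ∫ e^{-i x·ξ} f(x) dx` of `f ∈ L²(ℝ³)`. -/
def fourierAng (f : L2E3) (ξ : E3) : ℂ :=
  (𝓕 f : L2E3) ((2 * Real.pi)⁻¹ • ξ)

/-- The integrand `e^{iλ x·ω} b(x,ω) ℱf(λω) λ²`. -/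
def psdoIntegrand (b : E3 → S2 → ℂ) (f : L2E3) (x : E3) (ω : S2) (l : ℝ) : ℂ :=
  Complex.exp (Complex.I * ((l * inner ℝ x (ω : E3) : ℝ) : ℂ)) * b x ω *
    fourierAng f (l • (ω : E3)) * ((l ^ 2 : ℝ) : ℂ)

/-- The integral defining the operator with symbol `b` converges absolutely at `x`. -/
def PsdoConverges (b : E3 → S2 → ℂ) (f : L2E3) (x : E3) : Prop :=
  Integrable (fun p : S2 × ℝ => psdoIntegrand b f x p.1 p.2)
    (surfS2.prod (volume.restrict (Ioi (0 : ℝ))))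

/-- `Bf(x) = ∫_{𝕊²} ∫_0^∞ e^{iλ x·ω} b(x,ω) ℱf(λω) λ² dλ dω`. -/
def psdo (b : E3 → S2 → ℂ) (f : L2E3) (x : E3) : ℂ :=
  ∫ ω : S2, (∫ l in Ioi (0 : ℝ), psdoIntegrand b f x ω l) ∂surfS2

end

/-!
In frequency variables the operator has the kernel `K(ξ, ζ) = b̂(ξ - ζ, ζ/|ζ|)`, up to a constant,
where `b̂(·, ω)` is the Fourier transform of `b(·, ω)`. Its adjoint sends `h` to
`ζ ↦ ∫ conj K(ξ, ζ) ĥ(ξ) dξ = ∫ conj b(x, ζ/|ζ|) e^{-2πi x·ζ} h(x) dx` (`adjointTransform`), and it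
is enough to bound this map on `L²`. Write `η = ξ - ζ`, `ω = ζ/|ζ|`, let `η_⊥` be the component of
`η` orthogonal to `ω`, and split the `ξ`-integral at `4|η| = |ζ|`.

* Far from the diagonal, `|ζ| ≤ 4|η|`, the kernel is Hilbert–Schmidt: for fixed `ω`, integrating
  `l² |b̂(η, ω)|²` over `0 < l ≤ 4|η|` gives at most `64 |η|³ |b̂(η, ω)|²`, and
  `∫ |η|³ |b̂(η, ω)|² dη` is controlled by the `H^{3/2}` norm (`lintegral_radial_tail_le`).
* Near the diagonal, the Cauchy–Schwarz inequality with the weight `(1 + |η|²)(1 + |η_⊥|²)`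
  (`weight`) reduces the bound to a Schur test. The weighted `L²` norm of `b̂` is controlled by the
  `H^{3/2}` norm and by `‖∇̸∇b‖_{L²} = (2π)² ‖|η| |η_⊥| b̂‖_{L²}`
  (`lintegral_fourier_le_of_hasWeakTangentialGradient`). The integral in `ζ` of the inverse weight
  is bounded because the components of `η` orthogonal to `ζ` and to `ξ` are comparable when
  `4|η| < |ζ|`, and `∫ dη / ((1 + |η|²)(1 + |η_⊥|²))` is finite for a fixed direction
  (`lintegral_inv_weight_dir_le`).

The bounds hold for each `ω`, so measurability of `b̂` in `ω` is never needed: the only function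
that has to be measurable in all variables is `b` itself, and `exists_goodSymbol` provides a
jointly measurable representative that satisfies the bounds for every `ω`.

The operator is `B = (2π)³ A^* 𝓕`, where `A` is the bounded extension of `adjointTransform`. It is
given by the integral wherever this converges absolutely: on bounded sets on which
`∫ |b(x, ζ/|ζ|)| |f̂(ζ)| dζ` is bounded, Fubini's theorem identifies the integrals of both sides
(`setIntegral_adjoint_eq`), and countably many such sets exhaust the points of convergence.
-/

noncomputable section

open SchwartzMap LineDeriv Filter Topology ComplexConjugate

/-! ### Fourier transform of weak second derivatives -/

/-- Weak derivatives may be tested against complex-valued functions. -/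
theorem HasWeakDirDeriv.integral_fderiv_mul {v : E3} {f g : E3 → ℂ} (h : HasWeakDirDeriv v f g)
    {φ : E3 → ℂ} (hφ : ContDiff ℝ (⊤ : ℕ∞) φ) (hc : HasCompactSupport φ) :
    ∫ x, fderiv ℝ φ x v * f x = - ∫ x, φ x * g x := by
  obtain ⟨hf, hg, H⟩ := h
  have hre : ContDiff ℝ (⊤ : ℕ∞) (fun x => (φ x).re) := Complex.reCLM.contDiff.comp hφ
  have him : ContDiff ℝ (⊤ : ℕ∞) (fun x => (φ x).im) := Complex.imCLM.contDiff.comp hφ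
  have cre : HasCompactSupport (fun x => (φ x).re) := hc.comp_left (g := Complex.re) rfl
  have cim : HasCompactSupport (fun x => (φ x).im) := hc.comp_left (g := Complex.im) rfl
  have hd : ∀ x, DifferentiableAt ℝ φ x := fun x => (hφ.differentiable (by simp)) x
  have dre : ∀ x, fderiv ℝ (fun x => (φ x).re) x v = (fderiv ℝ φ x v).re := by
    intro x
    have := (Complex.reCLM.hasFDerivAt.comp x (hd x).hasFDerivAt).fderiv
    simp only [Function.comp_def, Complex.reCLM_apply] at this
    rw [this]; simp
  have dim : ∀ x, fderiv ℝ (fun x => (φ x).im) x v = (fderiv ℝ φ x v).im := by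
    intro x
    have := (Complex.imCLM.hasFDerivAt.comp x (hd x).hasFDerivAt).fderiv
    simp only [Function.comp_def, Complex.imCLM_apply] at this
    rw [this]; simp
  have H1 := H _ hre cre
  have H2 := H _ him cim
  have int1 : ∀ {ψ : E3 → ℝ}, ContDiff ℝ (⊤ : ℕ∞) ψ → HasCompactSupport ψ →
      Integrable (fun x => (fderiv ℝ ψ x v) • f x) := fun {ψ} h1 h2 =>
    hf.integrable_smul_left_of_hasCompactSupport
      ((h1.continuous_fderiv (by simp)).clm_apply continuous_const)
      (h2.fderiv_apply ℝ v)
  have int2 : ∀ {ψ : E3 → ℝ}, ContDiff ℝ (⊤ : ℕ∞) ψ → HasCompactSupport ψ →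
      Integrable (fun x => ψ x • g x) := fun {ψ} h1 h2 =>
    hg.integrable_smul_left_of_hasCompactSupport h1.continuous h2
  have e1 : (fun x => fderiv ℝ φ x v * f x) = fun x =>
      (fderiv ℝ (fun x => (φ x).re) x v) • f x
        + Complex.I * ((fderiv ℝ (fun x => (φ x).im) x v) • f x) := by
    funext x
    rw [dre, dim, Complex.real_smul, Complex.real_smul, ← mul_assoc, ← add_mul,
      mul_comm Complex.I, Complex.re_add_im]
  have e2 : (fun x => φ x * g x) = fun x =>
      ((φ x).re) • g x + Complex.I * ((φ x).im • g x) := by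
    funext x
    rw [Complex.real_smul, Complex.real_smul, ← mul_assoc, ← add_mul,
      mul_comm Complex.I, Complex.re_add_im]
  rw [e1, e2, integral_add (int1 hre cre) ((int1 him cim).const_mul _),
    integral_add (int2 hre cre) ((int2 him cim).const_mul _), integral_const_mul,
    integral_const_mul, H1, H2]
  ring

theorem HasWeakDirDeriv.integral_fderiv_fderiv_mul {e v : E3} {b g h : E3 → ℂ}
    (hg : HasWeakDirDeriv e b g) (hh : HasWeakDirDeriv v g h)
    {φ : E3 → ℂ} (hφ : ContDiff ℝ (⊤ : ℕ∞) φ) (hc : HasCompactSupport φ) :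
    ∫ x, fderiv ℝ (fun y => fderiv ℝ φ y v) x e * b x = ∫ x, φ x * h x := by
  have h1 : ContDiff ℝ (⊤ : ℕ∞) (fun y => fderiv ℝ φ y v) :=
    (hφ.fderiv_right (m := (⊤ : ℕ∞)) (by simp)).clm_apply contDiff_const
  rw [hg.integral_fderiv_mul h1 (hc.fderiv_apply ℝ v), hh.integral_fderiv_mul hφ hc, neg_neg]

/-- A smooth bump function equal to `1` on the ball of radius `n + 1` and supported in the ball of
radius `2(n + 1)`; all are dilates of `cutoff 0`, so derivatives gain a factor `(n + 1)⁻¹`. -/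
def cutoff (n : ℕ) (x : E3) : ℝ :=
  (⟨1, 2, one_pos, one_lt_two⟩ : ContDiffBump (0 : E3)) (((n : ℝ) + 1)⁻¹ • x)

theorem contDiff_cutoff (n : ℕ) : ContDiff ℝ (⊤ : ℕ∞) (cutoff n) := by
  unfold cutoff
  exact (ContDiffBump.contDiff _).comp (contDiff_const_smul _)

theorem hasCompactSupport_cutoff (n : ℕ) : HasCompactSupport (cutoff n) := by
  unfold cutoff
  exact (ContDiffBump.hasCompactSupport _).comp_smul (by positivity)

theorem cutoff_eq (n : ℕ) : cutoff n = fun x => cutoff 0 (((n : ℝ) + 1)⁻¹ • x) := by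
  funext x; simp [cutoff]

theorem fderiv_cutoff (n : ℕ) (x v : E3) :
    fderiv ℝ (cutoff n) x v = ((n : ℝ) + 1)⁻¹ * fderiv ℝ (cutoff 0) (((n : ℝ) + 1)⁻¹ • x) v := by
  rw [cutoff_eq n, fderiv_comp_smul]; simp

theorem fderiv_fderiv_cutoff (n : ℕ) (x v e : E3) :
    fderiv ℝ (fun y => fderiv ℝ (cutoff n) y v) x e = ((n : ℝ) + 1)⁻¹ * (((n : ℝ) + 1)⁻¹ *
      fderiv ℝ (fun y => fderiv ℝ (cutoff 0) y v) (((n : ℝ) + 1)⁻¹ • x) e) := by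
  have : (fun y => fderiv ℝ (cutoff n) y v) = ((n : ℝ) + 1)⁻¹ •
      fun y => (fun z => fderiv ℝ (cutoff 0) z v) (((n : ℝ) + 1)⁻¹ • y) := by
    funext y; rw [fderiv_cutoff]; rfl
  rw [this, fderiv_const_smul_field, Pi.smul_apply,
    fderiv_comp_smul (f := fun z => fderiv ℝ (cutoff 0) z v)]; simp

theorem norm_cutoff_le (n : ℕ) (x : E3) : |cutoff n x| ≤ 1 := by
  unfold cutoff
  rw [abs_of_nonneg (ContDiffBump.nonneg _)]; exact ContDiffBump.le_one _

theorem tendsto_cutoff (x : E3) : Tendsto (fun n => cutoff n x) atTop (𝓝 1) := by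
  have h0 : cutoff 0 0 = 1 := by
    simp only [cutoff, smul_zero]; exact ContDiffBump.one_of_mem_closedBall _ (by simp)
  have : Tendsto (fun n : ℕ => ((n : ℝ) + 1)⁻¹ • x) atTop (𝓝 ((0 : ℝ) • x)) :=
    (tendsto_inv_atTop_nhds_zero_nat (𝕜 := ℝ) |>.comp (tendsto_add_atTop_nat 1) |>.congr
      (by intro n; simp)).smul_const x
  rw [zero_smul] at this
  have h2 := ((contDiff_cutoff 0).continuous.tendsto 0).comp this
  rw [h0] at h2
  refine h2.congr fun n => ?_
  rw [cutoff_eq n]; rfl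

theorem exists_bound_fderiv_cutoff (v : E3) : ∃ C, ∀ x, |fderiv ℝ (cutoff 0) x v| ≤ C :=
  (((contDiff_cutoff 0).continuous_fderiv (by simp)).clm_apply
    continuous_const).bounded_above_of_compact_support ((hasCompactSupport_cutoff 0).fderiv_apply ℝ v)

theorem exists_bound_fderiv_fderiv_cutoff (v e : E3) :
    ∃ C, ∀ x, |fderiv ℝ (fun y => fderiv ℝ (cutoff 0) y v) x e| ≤ C := by
  have h1 : ContDiff ℝ (⊤ : ℕ∞) (fun y => fderiv ℝ (cutoff 0) y v) :=
    ((contDiff_cutoff 0).fderiv_right (m := (⊤ : ℕ∞)) (by simp)).clm_apply contDiff_const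
  exact ((h1.continuous_fderiv (by simp)).clm_apply
    continuous_const).bounded_above_of_compact_support
      (((hasCompactSupport_cutoff 0).fderiv_apply ℝ v).fderiv_apply ℝ e)

theorem fderiv_fderiv_smul {a : E3 → ℝ} {p : E3 → ℂ} (ha : ContDiff ℝ (⊤ : ℕ∞) a)
    (hp : ContDiff ℝ (⊤ : ℕ∞) p) (x v e : E3) :
    fderiv ℝ (fun y => fderiv ℝ (fun z => a z • p z) y v) x e =
      a x • fderiv ℝ (fun y => fderiv ℝ p y v) x e + fderiv ℝ a x e • fderiv ℝ p x v +
      (fderiv ℝ a x v • fderiv ℝ p x e + fderiv ℝ (fun y => fderiv ℝ a y v) x e • p x) := by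
  have da : ∀ x, DifferentiableAt ℝ a x := fun x => (ha.differentiable (by simp)) x
  have dp : ∀ x, DifferentiableAt ℝ p x := fun x => (hp.differentiable (by simp)) x
  have da1 : ∀ x, DifferentiableAt ℝ (fun y => fderiv ℝ a y v) x := fun x =>
    (((ha.fderiv_right (m := (⊤ : ℕ∞)) (by simp)).clm_apply contDiff_const).differentiable
      (by simp)) x
  have dp1 : ∀ x, DifferentiableAt ℝ (fun y => fderiv ℝ p y v) x := fun x =>
    (((hp.fderiv_right (m := (⊤ : ℕ∞)) (by simp)).clm_apply contDiff_const).differentiable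
      (by simp)) x
  have h1 : (fun y => fderiv ℝ (fun z => a z • p z) y v) =
      fun y => a y • fderiv ℝ p y v + fderiv ℝ a y v • p y := by
    funext y
    rw [fderiv_fun_smul (da y) (dp y)]; simp
  rw [h1, fderiv_fun_add ((da x).fun_smul (dp1 x)) ((da1 x).fun_smul (dp x)),
    fderiv_fun_smul (da x) (dp1 x), fderiv_fun_smul (da1 x) (dp x)]
  simp

/-- The integration by parts that defines a weak second derivative in `L²` extends from compactly
supported to Schwartz test functions. The intermediate derivative `g` need not be in `L²`. -/
theorem HasWeakDirDeriv.integral_lineDerivOp_mul {e v : E3} {b g h : E3 → ℂ}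
    (hg : HasWeakDirDeriv e b g) (hh : HasWeakDirDeriv v g h) (hb2 : MemLp b 2 volume)
    (hh2 : MemLp h 2 volume) (φ : 𝓢(E3, ℂ)) :
    ∫ x, (∂_{e} (∂_{v} φ)) x * b x = ∫ x, φ x * h x := by
  have hφ : ContDiff ℝ (⊤ : ℕ∞) φ := φ.smooth _
  have key : ∀ n, ∫ x, fderiv ℝ (fun y => fderiv ℝ (fun z => cutoff n z • φ z) y v) x e * b x =
      ∫ x, (cutoff n x • φ x) * h x := fun n =>
    hg.integral_fderiv_fderiv_mul hh ((contDiff_cutoff n).smul hφ)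
      (hasCompactSupport_cutoff n).smul_right
  have mulInt : ∀ (ψ : 𝓢(E3, ℂ)) {u : E3 → ℂ}, MemLp u 2 volume →
      Integrable (fun x => ψ x * u x) := fun ψ u hu => (ψ.memLp 2 volume).integrable_mul hu
  have lim0 : Tendsto (fun n : ℕ => ((n : ℝ) + 1)⁻¹) atTop (𝓝 0) :=
    tendsto_inv_atTop_nhds_zero_nat (𝕜 := ℝ) |>.comp (tendsto_add_atTop_nat 1) |>.congr
      (by intro n; simp)
  have le1 : ∀ n : ℕ, ((n : ℝ) + 1)⁻¹ ≤ 1 := fun n => inv_le_one_of_one_le₀ (by simp)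
  have pos1 : ∀ n : ℕ, 0 ≤ ((n : ℝ) + 1)⁻¹ := fun n => by positivity
  have R : Tendsto (fun n => ∫ x, (cutoff n x • φ x) * h x) atTop (𝓝 (∫ x, φ x * h x)) := by
    refine tendsto_integral_of_dominated_convergence (fun x => ‖φ x * h x‖) ?_
      (mulInt φ hh2).norm ?_ ?_
    · intro n
      exact (((contDiff_cutoff n).continuous.smul hφ.continuous).aestronglyMeasurable).mul hh2.1
    · intro n
      refine .of_forall fun x => ?_
      rw [smul_mul_assoc, norm_smul]
      exact mul_le_of_le_one_left (norm_nonneg _) (norm_cutoff_le n x)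
    · refine .of_forall fun x => ?_
      have := ((tendsto_cutoff x).smul_const (φ x)).mul_const (h x)
      rwa [one_smul] at this
  have edd : ∀ x, fderiv ℝ (fun y => fderiv ℝ φ y v) x e = (∂_{e} (∂_{v} φ)) x := fun x => by
    rw [lineDerivOp_apply_eq_fderiv]; rfl
  have ed : ∀ x w, fderiv ℝ φ x w = (∂_{w} φ) x := fun x w => rfl
  obtain ⟨Cv, hCv⟩ := exists_bound_fderiv_cutoff v
  obtain ⟨Ce, hCe⟩ := exists_bound_fderiv_cutoff e
  obtain ⟨Cd, hCd⟩ := exists_bound_fderiv_fderiv_cutoff v e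
  have smallv : ∀ w C, (∀ x, |fderiv ℝ (cutoff 0) x w| ≤ C) → ∀ n x,
      |fderiv ℝ (cutoff n) x w| ≤ ((n : ℝ) + 1)⁻¹ * C := fun w C hC n x => by
    rw [fderiv_cutoff, abs_mul, abs_of_nonneg (pos1 n)]
    exact mul_le_mul_of_nonneg_left (hC _) (pos1 n)
  have smalld : ∀ n x, |fderiv ℝ (fun y => fderiv ℝ (cutoff n) y v) x e| ≤
      ((n : ℝ) + 1)⁻¹ * Cd := fun n x => by
    rw [fderiv_fderiv_cutoff, abs_mul, abs_mul, abs_of_nonneg (pos1 n)]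
    refine mul_le_mul_of_nonneg_left ?_ (pos1 n)
    exact (mul_le_of_le_one_left (abs_nonneg _) (le1 n)).trans (hCd _)
  have squeeze : ∀ (u : ℕ → ℝ) (C : ℝ), (∀ n, |u n| ≤ ((n : ℝ) + 1)⁻¹ * C) →
      Tendsto u atTop (𝓝 0) := fun u C hu =>
    squeeze_zero_norm hu (by simpa using lim0.mul_const C)
  have le2 : ∀ (C : ℝ), 0 ≤ C → ∀ n : ℕ, ((n : ℝ) + 1)⁻¹ * C ≤ C := fun C hC n =>
    mul_le_of_le_one_left hC (le1 n)
  have nn : ∀ {f : E3 → ℝ} {C}, (∀ x, |f x| ≤ C) → 0 ≤ C := fun h => (abs_nonneg _).trans (h 0)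
  have S : Tendsto (fun n => ∫ x,
      fderiv ℝ (fun y => fderiv ℝ (fun z => cutoff n z • φ z) y v) x e * b x) atTop
      (𝓝 (∫ x, (∂_{e} (∂_{v} φ)) x * b x)) := by
    refine tendsto_integral_of_dominated_convergence (fun x => ‖(∂_{e} (∂_{v} φ)) x * b x‖ +
      Ce * ‖(∂_{v} φ) x * b x‖ + (Cv * ‖(∂_{e} φ) x * b x‖ + Cd * ‖φ x * b x‖)) ?_ ?_ ?_ ?_
    · intro n
      have h1 : ContDiff ℝ (⊤ : ℕ∞) (fun z => cutoff n z • φ z) := (contDiff_cutoff n).smul hφ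
      have h2 : ContDiff ℝ (⊤ : ℕ∞) (fun y => fderiv ℝ (fun z => cutoff n z • φ z) y v) :=
        (h1.fderiv_right (m := (⊤ : ℕ∞)) (by simp)).clm_apply contDiff_const
      exact ((h2.continuous_fderiv (by simp)).clm_apply
        continuous_const).aestronglyMeasurable.mul hb2.1
    · exact ((mulInt _ hb2).norm.add ((mulInt _ hb2).norm.const_mul _)).add
        (((mulInt _ hb2).norm.const_mul _).add ((mulInt _ hb2).norm.const_mul _))
    · intro n
      refine .of_forall fun x => ?_
      rw [fderiv_fderiv_smul (contDiff_cutoff n) hφ, edd, ed, ed, add_mul, add_mul, add_mul]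
      simp only [smul_mul_assoc]
      refine (norm_add_le _ _).trans (add_le_add ((norm_add_le _ _).trans (add_le_add ?_ ?_))
        ((norm_add_le _ _).trans (add_le_add ?_ ?_))) <;> rw [norm_smul, Real.norm_eq_abs]
      · exact mul_le_of_le_one_left (norm_nonneg _) (norm_cutoff_le n x)
      · exact mul_le_mul_of_nonneg_right
          ((smallv e Ce hCe n x).trans (le2 _ (nn hCe) n)) (norm_nonneg _)
      · exact mul_le_mul_of_nonneg_right
          ((smallv v Cv hCv n x).trans (le2 _ (nn hCv) n)) (norm_nonneg _)
      · exact mul_le_mul_of_nonneg_right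
          ((smalld n x).trans (le2 _ (nn hCd) n)) (norm_nonneg _)
    · refine .of_forall fun x => ?_
      have := ((((tendsto_cutoff x).smul_const ((∂_{e} (∂_{v} φ)) x)).add
        ((squeeze _ Ce (fun n => smallv e Ce hCe n x)).smul_const ((∂_{v} φ) x))).add
        (((squeeze _ Cv (fun n => smallv v Cv hCv n x)).smul_const ((∂_{e} φ) x)).add
        ((squeeze _ Cd (fun n => smalld n x)).smul_const (φ x)))).mul_const (b x)
      simp only [one_smul, zero_smul, add_zero] at this
      refine this.congr fun n => ?_
      rw [fderiv_fderiv_smul (contDiff_cutoff n) hφ, edd, ed, ed]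
  exact tendsto_nhds_unique S ((tendsto_congr key).2 R)

/-- The multiplication formula for a Schwartz function and an `L²` function. -/
theorem integral_fourier_mul_Lp (φ : 𝓢(E3, ℂ)) (u : L2E3) :
    ∫ x, (𝓕 φ) x * u x = ∫ ξ, φ ξ * (𝓕 u : L2E3) ξ := by
  have := congrArg (fun T => T φ) (Lp.fourier_toTemperedDistribution_eq u)
  simpa [TemperedDistribution.fourier_apply] using this

/-- The Fourier transform of a weak second derivative. -/
theorem HasWeakDirDeriv.fourier_toLp_ae_eq {e v : E3} {b g h : E3 → ℂ}
    (hg : HasWeakDirDeriv e b g) (hh : HasWeakDirDeriv v g h) (hb2 : MemLp b 2 volume)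
    (hh2 : MemLp h 2 volume) :
    ∀ᵐ ξ, (𝓕 (hh2.toLp h) : L2E3) ξ =
      -((2 * Real.pi) ^ 2 * inner ℝ ξ e * inner ℝ ξ v : ℝ) * (𝓕 (hb2.toLp b) : L2E3) ξ := by
  have l1 : ∀ u : L2E3, LocallyIntegrable u := fun u =>
    (Lp.memLp u).locallyIntegrable (by norm_num)
  refine ae_eq_of_integral_contDiff_smul_eq (l1 _) ?_ fun ψ hψ hc => ?_
  · refine LocallyIntegrable.continuous_mul (g := fun ξ : E3 =>
      (-((2 * Real.pi) ^ 2 * inner ℝ ξ e * inner ℝ ξ v : ℝ) : ℂ)) ?_ (l1 _)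
    fun_prop
  · have hψ' : ContDiff ℝ (⊤ : ℕ∞) (fun x => (ψ x : ℂ)) := Complex.ofRealCLM.contDiff.comp hψ
    have hc' : HasCompactSupport (fun x => (ψ x : ℂ)) := hc.comp_left Complex.ofReal_zero
    set φ : 𝓢(E3, ℂ) := hc'.toSchwartzMap hψ' with hφ
    have hφx : ∀ x, φ x = ψ x := fun x => rfl
    have te : (fun x : E3 => inner ℝ x e).HasTemperateGrowth := by fun_prop
    have tv : (fun x : E3 => inner ℝ x v).HasTemperateGrowth := by fun_prop
    have A := hg.integral_lineDerivOp_mul hh hb2 hh2 (𝓕 φ)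
    have B1 : ∫ x, (𝓕 φ) x * h x = ∫ x, (𝓕 φ) x * (hh2.toLp h) x :=
      integral_congr_ae (by filter_upwards [hh2.coeFn_toLp] with x hx; rw [hx])
    have B2 : ∫ x, (∂_{e} (∂_{v} (𝓕 φ))) x * b x =
        ∫ x, (∂_{e} (∂_{v} (𝓕 φ))) x * (hb2.toLp b) x :=
      integral_congr_ae (by filter_upwards [hb2.coeFn_toLp] with x hx; rw [hx])
    rw [B1, B2, integral_fourier_mul_Lp, lineDerivOp_fourier_eq, lineDerivOp_fourier_eq,
      integral_fourier_mul_Lp] at A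
    simp only [Complex.real_smul, ← hφx]
    rw [← A]
    refine integral_congr_ae (.of_forall fun ξ => ?_)
    simp [te, tv]
    ring_nf
    simp

/-! ### Weighted bounds on the Fourier transform of the symbol -/

/-- The component of `ξ` orthogonal to the unit vector `ω`. -/
def perpPart (ω ξ : E3) : E3 := ξ - inner ℝ ω ξ • ω

/-- The weight `(1 + |ξ|²)(1 + |ξ_⊥|²)`, where `ξ_⊥` is the component of `ξ` orthogonal to `ω`. -/
def weight (ω ξ : E3) : ℝ := (1 + ‖ξ‖ ^ 2) * (1 + ‖perpPart ω ξ‖ ^ 2)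

theorem weight_pos (ω ξ : E3) : 0 < weight ω ξ := by unfold weight; positivity

theorem lintegral_enorm_sq_coe_Lp (u : L2E3) : ∫⁻ x, ‖u x‖ₑ ^ 2 = ‖u‖ₑ ^ 2 := by
  have h := eLpNorm_eq_lintegral_rpow_enorm_toReal (f := u) (μ := (volume : Measure E3))
    (p := 2) (by norm_num) (by norm_num)
  rw [Lp.enorm_def, h, ← ENNReal.rpow_natCast, ← ENNReal.rpow_mul]
  norm_num

theorem lintegral_enorm_sq_fourier (u : L2E3) :
    ∫⁻ x, ‖(𝓕 u : L2E3) x‖ₑ ^ 2 = ‖u‖ₑ ^ 2 := by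
  rw [lintegral_enorm_sq_coe_Lp, ← ofReal_norm, ← ofReal_norm, Lp.norm_fourier_eq]

theorem norm_sq_perpPart_eq_sum (ω : S2) (ξ : E3) :
    ‖perpPart ω ξ‖ ^ 2 = ∑ i, inner ℝ ξ (stdVec i - (ω : E3) i • (ω : E3)) ^ 2 := by
  rw [EuclideanSpace.norm_sq_eq]
  refine Finset.sum_congr rfl fun i _ => ?_
  simp [perpPart, stdVec, inner_sub_right, inner_smul_right, real_inner_comm, mul_comm,
    EuclideanSpace.inner_single_right]

theorem norm_perpPart_le (ω : S2) (ξ : E3) : ‖perpPart ω ξ‖ ≤ ‖ξ‖ := by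
  have h1 : ‖(ω : E3)‖ = 1 := by simp
  have : ‖perpPart ω ξ‖ ^ 2 = ‖ξ‖ ^ 2 - inner ℝ (ω : E3) ξ ^ 2 := by
    rw [perpPart, norm_sub_sq_real, norm_smul, inner_smul_right, h1, real_inner_comm]
    simp; ring
  nlinarith [sq_nonneg (inner ℝ (ω : E3) ξ), norm_nonneg ξ, norm_nonneg (perpPart ω ξ)]

/-- `‖∇̸∇b‖_{L²}` controls `∫ |ξ|² |ξ_⊥|² |b̂|²`. -/
theorem lintegral_fourier_le_of_hasWeakTangentialGradient (ω : S2) {b : E3 → ℂ}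
    {G : E3 → EuclideanSpace ℂ (Fin 3)} {H : E3 → EuclideanSpace ℂ (Fin 3 × Fin 3)}
    (hG : HasWeakGradient b G) (hH : HasWeakTangentialGradient ω G H) (hb : MemLp b 2 volume)
    (hfin : eLpNorm H 2 volume ≠ ⊤) :
    ∫⁻ ξ, ENNReal.ofReal ((2 * Real.pi) ^ 4 * (‖ξ‖ ^ 2 * ‖perpPart ω ξ‖ ^ 2)) *
      ‖(𝓕 (hb.toLp b) : L2E3) ξ‖ₑ ^ 2 ≤ eLpNorm H 2 volume ^ 2 := by
  have hm : ∀ i j, AEStronglyMeasurable (fun x => H x (i, j)) volume := fun i j =>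
    (hH i j).2.1.aestronglyMeasurable
  have hle : ∀ i j x, ‖H x (i, j)‖ₑ ≤ ‖H x‖ₑ := fun i j x => by
    rw [enorm_le_iff_norm_le]; exact PiLp.norm_apply_le (H x) (i, j)
  have hmem : ∀ i j, MemLp (fun x => H x (i, j)) 2 volume := fun i j =>
    ⟨hm i j, (eLpNorm_mono_enorm (hle i j)).trans_lt hfin.lt_top⟩
  have hF := fun i j => (hG j).fourier_toLp_ae_eq (hH i j) hb (hmem i j)
  -- Both sides are sums over the entries of `H`; the identity `|ξ_⊥|² = Σ_i (ξ · (e_i - ω_i ω))²`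
  -- then matches the sum of the Fourier multipliers.
  have hHeq : eLpNorm H 2 volume ^ 2 = ∑ i, ∑ j, ∫⁻ x, ‖H x (i, j)‖ₑ ^ 2 := by
    have h := eLpNorm_eq_lintegral_rpow_enorm_toReal (f := H) (μ := (volume : Measure E3))
      (p := 2) (by norm_num) (by norm_num)
    rw [h, ← ENNReal.rpow_natCast, ← ENNReal.rpow_mul]
    have : ∀ x, ‖H x‖ₑ ^ 2 = ∑ i, ∑ j, ‖H x (i, j)‖ₑ ^ 2 := fun x => by
      rw [← ofReal_norm, ← ENNReal.ofReal_pow (norm_nonneg _), EuclideanSpace.norm_sq_eq,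
        Fintype.sum_prod_type, ENNReal.ofReal_sum_of_nonneg (fun i _ => by positivity)]
      refine Finset.sum_congr rfl fun i _ => ?_
      rw [ENNReal.ofReal_sum_of_nonneg (fun i _ => by positivity)]
      refine Finset.sum_congr rfl fun j _ => ?_
      rw [← ofReal_norm, ← ENNReal.ofReal_pow (norm_nonneg _)]
    norm_num
    simp only [this]
    rw [lintegral_finsetSum' _ fun i _ =>
      Finset.aemeasurable_fun_sum _ fun j _ => (hm i j).enorm.pow_const 2]
    refine Finset.sum_congr rfl fun i _ => ?_
    rw [lintegral_finsetSum' _ fun j _ => (hm i j).enorm.pow_const 2]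
  have hP : ∀ i j, ∫⁻ x, ‖H x (i, j)‖ₑ ^ 2 =
      ∫⁻ ξ, ENNReal.ofReal ((2 * Real.pi) ^ 4 * ((ξ j) ^ 2 *
        inner ℝ ξ (stdVec i - (ω : E3) i • (ω : E3)) ^ 2)) *
        ‖(𝓕 (hb.toLp b) : L2E3) ξ‖ₑ ^ 2 := fun i j => by
    have e1 : ∫⁻ x, ‖H x (i, j)‖ₑ ^ 2 = ∫⁻ x, ‖((hmem i j).toLp _) x‖ₑ ^ 2 :=
      lintegral_congr_ae (by filter_upwards [(hmem i j).coeFn_toLp] with x hx; rw [hx])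
    rw [e1, lintegral_enorm_sq_coe_Lp, ← lintegral_enorm_sq_fourier]
    refine lintegral_congr_ae ?_
    filter_upwards [hF i j] with ξ hξ
    rw [hξ, enorm_mul, mul_pow]
    congr 1
    have hs : inner ℝ ξ (stdVec j) = ξ j := by simp [stdVec, EuclideanSpace.inner_single_right]
    rw [← ofReal_norm, ← ENNReal.ofReal_pow (norm_nonneg _), norm_neg, Complex.norm_real,
      Real.norm_eq_abs, sq_abs, hs]
    congr 1; ring
  rw [hHeq]
  simp only [hP]
  have meas : ∀ i j : Fin 3, AEMeasurable (fun ξ : E3 =>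
      ENNReal.ofReal ((2 * Real.pi) ^ 4 * ((ξ j) ^ 2 *
        inner ℝ ξ (stdVec i - (ω : E3) i • (ω : E3)) ^ 2)) *
        ‖(𝓕 (hb.toLp b) : L2E3) ξ‖ₑ ^ 2) volume := fun i j => by
    refine AEMeasurable.mul ?_ ((Lp.stronglyMeasurable _).measurable.enorm.pow_const 2).aemeasurable
    exact (Continuous.measurable (by fun_prop)).ennreal_ofReal.aemeasurable
  rw [Finset.sum_congr rfl fun i _ => (lintegral_finsetSum' Finset.univ fun j _ => meas i j).symm,
    ← lintegral_finsetSum' _ fun i _ => Finset.aemeasurable_fun_sum _ fun j _ => meas i j]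
  refine lintegral_mono fun ξ => le_of_eq ?_
  dsimp only
  rw [Finset.sum_congr rfl fun i _ => (Finset.sum_mul Finset.univ _ _).symm, ← Finset.sum_mul,
    Finset.sum_congr rfl fun i _ => (ENNReal.ofReal_sum_of_nonneg fun j _ => by positivity).symm,
    ← ENNReal.ofReal_sum_of_nonneg (fun i _ => Finset.sum_nonneg fun j _ => by positivity)]
  congr 2
  rw [norm_sq_perpPart_eq_sum, EuclideanSpace.norm_sq_eq, Finset.sum_mul_sum, Finset.sum_comm,
    Finset.mul_sum]
  simp_rw [Finset.mul_sum]
  simp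

/-- The weight is controlled by the `H^{3/2}` weight and the multiplier of `∇̸∇`. -/
theorem weight_le (ω : S2) (ξ : E3) :
    weight ω ξ ≤ 2 * (1 + (2 * Real.pi * ‖ξ‖) ^ 2) ^ (3 / 2 : ℝ) +
      (2 * Real.pi) ^ 4 * (‖ξ‖ ^ 2 * ‖perpPart ω ξ‖ ^ 2) := by
  have hp : 1 ≤ 2 * Real.pi := by linarith [Real.pi_gt_three]
  have h1 : 1 + ‖ξ‖ ^ 2 ≤ (1 + (2 * Real.pi * ‖ξ‖) ^ 2) ^ (3 / 2 : ℝ) := by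
    calc 1 + ‖ξ‖ ^ 2 ≤ 1 + (2 * Real.pi * ‖ξ‖) ^ 2 := by
          gcongr; exact le_mul_of_one_le_left (norm_nonneg _) hp
      _ = (1 + (2 * Real.pi * ‖ξ‖) ^ 2) ^ (1 : ℝ) := (Real.rpow_one _).symm
      _ ≤ _ := Real.rpow_le_rpow_of_exponent_le (by nlinarith [sq_nonneg (2 * Real.pi * ‖ξ‖)])
          (by norm_num)
  have h2 : ‖perpPart ω ξ‖ ^ 2 ≤ ‖ξ‖ ^ 2 := by gcongr; exact norm_perpPart_le ω ξ
  have h3 : ‖ξ‖ ^ 2 * ‖perpPart ω ξ‖ ^ 2 ≤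
      (2 * Real.pi) ^ 4 * (‖ξ‖ ^ 2 * ‖perpPart ω ξ‖ ^ 2) :=
    le_mul_of_one_le_left (by positivity) (one_le_pow₀ hp)
  unfold weight
  nlinarith

theorem norm_pow_three_le (ξ : E3) :
    ‖ξ‖ ^ 3 ≤ (1 + (2 * Real.pi * ‖ξ‖) ^ 2) ^ (3 / 2 : ℝ) := by
  have hp : 1 ≤ 2 * Real.pi := by linarith [Real.pi_gt_three]
  have : ‖ξ‖ ^ 3 = (‖ξ‖ ^ 2) ^ (3 / 2 : ℝ) := by
    rw [← Real.rpow_natCast, ← Real.rpow_natCast, ← Real.rpow_mul (norm_nonneg _)]; norm_num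
  rw [this]
  refine Real.rpow_le_rpow (by positivity) ?_ (by norm_num)
  have : ‖ξ‖ ^ 2 ≤ (2 * Real.pi * ‖ξ‖) ^ 2 := by
    gcongr; exact le_mul_of_one_le_left (norm_nonneg _) hp
  linarith

/-- `b` agrees almost everywhere with an element of `L²`, and its Fourier transform is square integrable against `weight ω` and
`|ξ|³`, with both squared norms at most `K`. -/
def FourierBound (K : ℝ≥0∞) (ω : S2) (b : E3 → ℂ) : Prop :=
  ∃ u : L2E3, u =ᵐ[volume] b ∧
    ∫⁻ ξ, ENNReal.ofReal (weight ω ξ) * ‖(𝓕 u : L2E3) ξ‖ₑ ^ 2 ≤ K ∧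
    ∫⁻ ξ : E3, ENNReal.ofReal (‖ξ‖ ^ 3) * ‖(𝓕 u : L2E3) ξ‖ₑ ^ 2 ≤ K

theorem fourierBound_of_sobolevNorm_add_le (ω : S2) {b : E3 → ℂ} {D : ℝ}
    {G : E3 → EuclideanSpace ℂ (Fin 3)} {H : E3 → EuclideanSpace ℂ (Fin 3 × Fin 3)}
    (hG : HasWeakGradient b G) (hH : HasWeakTangentialGradient ω G H)
    (hs : sobolevNorm (3 / 2) b ≤ ENNReal.ofReal D) (hn : eLpNorm H 2 volume ≤ ENNReal.ofReal D) :
    FourierBound (3 * ENNReal.ofReal D ^ 2) ω b := by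
  have hb : MemLp b 2 volume := by
    by_contra h
    rw [sobolevNorm, dif_neg h] at hs
    exact absurd hs (by simp)
  rw [sobolevNorm, dif_pos hb] at hs
  set u : L2E3 := hb.toLp b
  have hS : ∫⁻ ξ : E3, ENNReal.ofReal ((1 + (2 * Real.pi * ‖ξ‖) ^ 2) ^ (3 / 2 : ℝ)) *
      ‖(𝓕 u : L2E3) ξ‖ₑ ^ 2 ≤ ENNReal.ofReal D ^ 2 := by
    rw [one_div] at hs
    have := (ENNReal.rpow_inv_le_iff (by norm_num)).1 hs
    simpa using this
  have hT := (lintegral_fourier_le_of_hasWeakTangentialGradient ω hG hH hb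
    (hn.trans_lt ENNReal.ofReal_lt_top).ne).trans (pow_le_pow_left' hn 2)
  refine ⟨u, hb.coeFn_toLp, ?_, ?_⟩
  · calc ∫⁻ ξ, ENNReal.ofReal (weight ω ξ) * ‖(𝓕 u : L2E3) ξ‖ₑ ^ 2
      ≤ ∫⁻ ξ, (2 * (ENNReal.ofReal ((1 + (2 * Real.pi * ‖ξ‖) ^ 2) ^ (3 / 2 : ℝ)) *
          ‖(𝓕 u : L2E3) ξ‖ₑ ^ 2) +
          ENNReal.ofReal ((2 * Real.pi) ^ 4 * (‖ξ‖ ^ 2 * ‖perpPart ω ξ‖ ^ 2)) *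
          ‖(𝓕 u : L2E3) ξ‖ₑ ^ 2) := by
          refine lintegral_mono fun ξ => ?_
          rw [← mul_assoc, ← add_mul]
          refine mul_le_mul_left ?_ _
          refine (ENNReal.ofReal_le_ofReal (weight_le ω ξ)).trans_eq ?_
          rw [ENNReal.ofReal_add (by positivity) (by positivity),
            ENNReal.ofReal_mul (by norm_num)]
          norm_num
      _ ≤ 2 * ENNReal.ofReal D ^ 2 + ENNReal.ofReal D ^ 2 := by
          rw [lintegral_add_left', lintegral_const_mul']
          · gcongr
          · norm_num
          · refine AEMeasurable.const_mul (AEMeasurable.mul ?_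
              ((Lp.stronglyMeasurable _).measurable.enorm.pow_const 2).aemeasurable) _
            refine (Continuous.measurable ?_).ennreal_ofReal.aemeasurable
            refine Continuous.rpow_const (by fun_prop) fun x => Or.inr (by norm_num)
      _ = 3 * ENNReal.ofReal D ^ 2 := by ring
  · calc _ ≤ _ := lintegral_mono fun ξ => mul_le_mul_left
          (ENNReal.ofReal_le_ofReal (norm_pow_three_le ξ)) _
      _ ≤ ENNReal.ofReal D ^ 2 := hS
      _ ≤ 3 * ENNReal.ofReal D ^ 2 := le_mul_of_one_le_left (by simp) (by norm_num)

/-! ### Polar coordinates -/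

/-- The direction `ζ / |ζ|` of a vector; the value at `ζ = 0` is irrelevant. -/
def dir (ζ : E3) : S2 :=
  open Classical in
  ⟨if ζ = 0 then stdVec 0 else ‖ζ‖⁻¹ • ζ, by
    split_ifs with h
    · simp [stdVec]
    · simp [norm_smul, h]⟩

theorem coe_dir {ζ : E3} (h : ζ ≠ 0) : (dir ζ : E3) = ‖ζ‖⁻¹ • ζ := by simp [dir, h]

theorem dir_smul (ω : S2) {l : ℝ} (hl : 0 < l) : dir (l • (ω : E3)) = ω := by
  have h1 : ‖(ω : E3)‖ = 1 := by simp
  have h0 : (ω : E3) ≠ 0 := by rw [← norm_ne_zero_iff, h1]; norm_num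
  apply Subtype.ext
  rw [coe_dir (smul_ne_zero hl.ne' h0), norm_smul, h1, smul_smul]
  simp [abs_of_pos hl, hl.ne']

theorem measurable_dir : Measurable dir := by
  refine Measurable.subtype_mk ?_
  exact Measurable.ite (measurableSet_singleton 0) measurable_const (by fun_prop)

/-- The measure `l² dl` on the half-line `l > 0`. -/
def radialMeasure : Measure ℝ :=
  (volume.restrict (Ioi (0 : ℝ))).withDensity fun l => ENNReal.ofReal (l ^ 2)

instance : SFinite radialMeasure := by unfold radialMeasure; infer_instance

/-- Integration in polar coordinates. -/
theorem measurePreserving_polar :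
    MeasurePreserving (fun p : S2 × ℝ => p.2 • (p.1 : E3)) (surfS2.prod radialMeasure) volume := by
  have hm : Measurable (fun p : S2 × ℝ => p.2 • (p.1 : E3)) :=
    measurable_snd.smul (measurable_subtype_coe.comp measurable_fst)
  refine ⟨hm, ?_⟩
  have h1 : MeasurePreserving (Subtype.val : Ioi (0 : ℝ) → ℝ) (Measure.volumeIoiPow 2)
      radialMeasure := by
    refine ⟨measurable_subtype_coe, Measure.ext fun s hs => ?_⟩
    rw [Measure.map_apply measurable_subtype_coe hs, Measure.volumeIoiPow, radialMeasure,
      withDensity_apply _ (measurable_subtype_coe hs), withDensity_apply _ hs,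
      ← lintegral_indicator (measurable_subtype_coe hs), ← lintegral_indicator hs,
      ← lintegral_subtype_comap measurableSet_Ioi]
    rfl
  have h2 := (MeasurePreserving.id surfS2).prod h1
  have h3 := (Measure.measurePreserving_homeomorphUnitSphereProd (volume : Measure E3)).symm
    (homeomorphUnitSphereProd E3).toMeasurableEquiv
  have hd : Module.finrank ℝ E3 - 1 = 2 := by simp
  rw [hd] at h3
  have h4 : MeasurePreserving (Subtype.val : ({0}ᶜ : Set E3) → E3)
      ((volume : Measure E3).comap (↑)) volume := by
    have := measurePreserving_subtype_coe (μa := (volume : Measure E3))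
      (measurableSet_singleton (0 : E3)).compl
    rwa [restrict_compl_singleton] at this
  rw [← h2.map_eq, Measure.map_map hm h2.measurable, ← (h4.comp h3).map_eq]
  rfl

theorem lintegral_polar {F : E3 → ℝ≥0∞} (hF : Measurable F) :
    ∫⁻ ζ, F ζ = ∫⁻ ω : S2, (∫⁻ l in Ioi (0 : ℝ), ENNReal.ofReal (l ^ 2) * F (l • (ω : E3)))
      ∂surfS2 := by
  have hm : Measurable (fun p : S2 × ℝ => F (p.2 • (p.1 : E3))) :=
    hF.comp measurePreserving_polar.measurable
  rw [← measurePreserving_polar.lintegral_comp hF, lintegral_prod _ hm.aemeasurable]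
  refine lintegral_congr fun ω => ?_
  exact lintegral_withDensity_eq_lintegral_mul _ (by fun_prop) (hm.comp measurable_prodMk_left)

/-! ### Integral of the inverse weight near the diagonal -/

theorem exists_linearIsometryEquiv_apply_eq {e : E3} (he : ‖e‖ = 1) :
    ∃ R : E3 ≃ₗᵢ[ℝ] E3, R e = stdVec 0 :=
  ⟨_, Submodule.reflection_sub (v := e) (w := stdVec 0) (by simp [he, stdVec])⟩

theorem weight_map (R : E3 ≃ₗᵢ[ℝ] E3) (e ξ : E3) : weight (R e) (R ξ) = weight e ξ := by
  have : perpPart (R e) (R ξ) = R (perpPart e ξ) := by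
    simp [perpPart, R.inner_map_map]
  simp [weight, this]

/-- The weight dominates a product of one-variable weights `(1 + t²)^{5/8}`. The exponent exceeds
`1/2`, so the inverse of the product is integrable. -/
theorem prod_rpow_le_weight (ξ : E3) :
    ∏ i, (1 + ‖ξ i‖ ^ 2) ^ (5 / 8 : ℝ) ≤ weight (stdVec 0) ξ := by
  have h0 : ‖ξ‖ ^ 2 = ‖ξ 0‖ ^ 2 + ‖ξ 1‖ ^ 2 + ‖ξ 2‖ ^ 2 := by
    rw [EuclideanSpace.norm_sq_eq, Fin.sum_univ_three]
  have h1 : ‖perpPart (stdVec 0) ξ‖ ^ 2 = ‖ξ 1‖ ^ 2 + ‖ξ 2‖ ^ 2 := by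
    rw [EuclideanSpace.norm_sq_eq, Fin.sum_univ_three]
    simp [perpPart, stdVec, EuclideanSpace.inner_single_left]
  rw [weight, h0, h1, Fin.prod_univ_three]
  set a := ‖ξ 0‖ ^ 2
  set b := ‖ξ 1‖ ^ 2
  set c := ‖ξ 2‖ ^ 2
  have ha : 0 ≤ a := by positivity
  have hb : 0 ≤ b := by positivity
  have hc : 0 ≤ c := by positivity
  have e1 : 1 + (a + b + c) = (1 + (a + b + c)) ^ (5 / 8 : ℝ) * (1 + (a + b + c)) ^ (3 / 8 : ℝ) := by
    rw [← Real.rpow_add (by positivity)]; norm_num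
  have e2 : (1 + (b + c)) ^ (3 / 8 : ℝ) * (1 + (b + c)) ^ (7 / 8 : ℝ) =
      ((1 + (b + c)) * (1 + (b + c))) ^ (5 / 8 : ℝ) := by
    rw [Real.mul_rpow (by positivity) (by positivity), ← Real.rpow_add (by positivity),
      ← Real.rpow_add (by positivity)]; norm_num
  calc (1 + a) ^ (5 / 8 : ℝ) * (1 + b) ^ (5 / 8 : ℝ) * (1 + c) ^ (5 / 8 : ℝ)
      = (1 + a) ^ (5 / 8 : ℝ) * ((1 + b) * (1 + c)) ^ (5 / 8 : ℝ) := by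
        rw [Real.mul_rpow (by positivity) (by positivity), mul_assoc]
    _ ≤ (1 + (a + b + c)) ^ (5 / 8 : ℝ) * ((1 + (b + c)) * (1 + (b + c))) ^ (5 / 8 : ℝ) := by
        gcongr <;> linarith
    _ = (1 + (a + b + c)) ^ (5 / 8 : ℝ) *
          ((1 + (b + c)) ^ (3 / 8 : ℝ) * (1 + (b + c)) ^ (7 / 8 : ℝ)) := by rw [e2]
    _ ≤ (1 + (a + b + c)) ^ (5 / 8 : ℝ) *
          ((1 + (a + b + c)) ^ (3 / 8 : ℝ) * (1 + (b + c)) ^ (1 : ℝ)) := by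
        have : (1 + (b + c)) ^ (7 / 8 : ℝ) ≤ (1 + (b + c)) ^ (1 : ℝ) :=
          Real.rpow_le_rpow_of_exponent_le (by linarith) (by norm_num)
        gcongr; linarith
    _ = (1 + (a + b + c)) * (1 + (b + c)) := by
        rw [← mul_assoc, ← e1, Real.rpow_one]

theorem lintegral_inv_weight_stdVec_lt_top :
    ∫⁻ ξ, ENNReal.ofReal (weight (stdVec 0) ξ)⁻¹ < ⊤ := by
  have h1 : Integrable (fun t : ℝ => (1 + ‖t‖ ^ 2) ^ (-(5 / 4 : ℝ) / 2)) volume :=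
    integrable_rpow_neg_one_add_norm_sq (by simp; norm_num)
  have h2 : Integrable (fun x : Fin 3 → ℝ => ∏ i, (1 + ‖x i‖ ^ 2) ^ (-(5 / 4 : ℝ) / 2)) volume :=
    Integrable.fintype_prod (fun _ => h1)
  have h3 := (PiLp.volume_preserving_ofLp (Fin 3)).integrable_comp_of_integrable h2
  refine lt_of_le_of_lt (lintegral_mono fun ξ => ENNReal.ofReal_le_ofReal ?_) h3.lintegral_lt_top
  have : ∀ t : ℝ, (1 + ‖t‖ ^ 2) ^ (-(5 / 4 : ℝ) / 2) = ((1 + ‖t‖ ^ 2) ^ (5 / 8 : ℝ))⁻¹ := by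
    intro t
    rw [← Real.rpow_neg (by positivity)]; norm_num
  simp only [Function.comp, this, Finset.prod_inv_distrib]
  exact inv_anti₀ (Finset.prod_pos fun i _ => by positivity) (prod_rpow_le_weight ξ)

theorem measurable_weight : Measurable (fun p : E3 × E3 => weight p.1 p.2) := by
  unfold weight perpPart
  exact Continuous.measurable (by fun_prop)

/-- By rotation invariance the integral of the inverse weight does not depend on the direction. -/
theorem lintegral_inv_weight {e : E3} (he : ‖e‖ = 1) :
    ∫⁻ ξ, ENNReal.ofReal (weight e ξ)⁻¹ = ∫⁻ ξ, ENNReal.ofReal (weight (stdVec 0) ξ)⁻¹ := by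
  obtain ⟨R, hR⟩ := exists_linearIsometryEquiv_apply_eq he
  have hm : Measurable fun ξ => ENNReal.ofReal (weight (stdVec 0) ξ)⁻¹ :=
    (measurable_weight.comp measurable_prodMk_left).inv.ennreal_ofReal
  rw [← R.measurePreserving.lintegral_comp hm]
  simp_rw [← hR, weight_map]

/-- If `ζ` is close to `ξ`, the components of `ξ - ζ` orthogonal to `ζ` and to `ξ` are comparable. -/
theorem weight_dir_le {ξ ζ : E3} (h : 4 * ‖ξ - ζ‖ < ‖ζ‖) :
    weight (dir ξ) (ξ - ζ) ≤ 2 * weight (dir ζ) (ξ - ζ) := by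
  have hζ : 0 < ‖ζ‖ := lt_of_le_of_lt (by positivity) h
  have hle : 3 / 4 * ‖ζ‖ ≤ ‖ξ‖ := by
    have := norm_sub_norm_le ζ ξ
    rw [norm_sub_rev] at this
    linarith
  have hξ : 0 < ‖ξ‖ := lt_of_lt_of_le (by positivity) hle
  have key : ∀ {x : E3}, 0 < ‖x‖ → ∀ y, ‖x‖ ^ 2 * ‖perpPart (dir x) y‖ ^ 2 =
      ‖x‖ ^ 2 * ‖y‖ ^ 2 - inner ℝ x y ^ 2 := fun {x} hx y => by
    have h1 : ‖(dir x : E3)‖ = 1 := by simp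
    rw [perpPart, norm_sub_sq_real, norm_smul, inner_smul_right, h1,
      coe_dir (norm_pos_iff.1 hx), inner_smul_left, inner_smul_right, real_inner_comm x y]
    simp only [conj_trivial, Real.norm_eq_abs, mul_one, sq_abs]
    field_simp; ring
  have kξ := key hξ (ξ - ζ)
  have kζ := key hζ (ξ - ζ)
  -- Both sides are `|ξ × ζ|²`.
  have e : ‖ξ‖ ^ 2 * ‖perpPart (dir ξ) (ξ - ζ)‖ ^ 2 =
      ‖ζ‖ ^ 2 * ‖perpPart (dir ζ) (ξ - ζ)‖ ^ 2 := by
    rw [kξ, kζ, norm_sub_sq_real, inner_sub_right, inner_sub_right, real_inner_self_eq_norm_sq,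
      real_inner_self_eq_norm_sq, real_inner_comm ξ ζ]
    ring
  have h9 : 9 / 16 * ‖ζ‖ ^ 2 ≤ ‖ξ‖ ^ 2 := by nlinarith
  have hp : ‖perpPart (dir ξ) (ξ - ζ)‖ ^ 2 ≤ 2 * ‖perpPart (dir ζ) (ξ - ζ)‖ ^ 2 := by
    have h2 : 9 / 16 * ‖ζ‖ ^ 2 * ‖perpPart (dir ξ) (ξ - ζ)‖ ^ 2 ≤
        ‖ζ‖ ^ 2 * ‖perpPart (dir ζ) (ξ - ζ)‖ ^ 2 :=
      (mul_le_mul_of_nonneg_right h9 (by positivity)).trans_eq e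
    have h3 : ‖ζ‖ ^ 2 * (9 / 16 * ‖perpPart (dir ξ) (ξ - ζ)‖ ^ 2) ≤
        ‖ζ‖ ^ 2 * ‖perpPart (dir ζ) (ξ - ζ)‖ ^ 2 := by linarith
    have h4 := le_of_mul_le_mul_left h3 (by positivity)
    nlinarith [sq_nonneg ‖perpPart (dir ξ) (ξ - ζ)‖, sq_nonneg ‖perpPart (dir ζ) (ξ - ζ)‖]
  unfold weight
  have : 0 ≤ 1 + ‖ξ - ζ‖ ^ 2 := by positivity
  nlinarith

/-- The Schur test near the diagonal: the direction in the weight varies with `ζ`, but may be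
replaced by that of `ξ`. -/
theorem lintegral_inv_weight_dir_le (ξ : E3) :
    ∫⁻ ζ in {ζ | 4 * ‖ξ - ζ‖ < ‖ζ‖}, ENNReal.ofReal (weight (dir ζ) (ξ - ζ))⁻¹ ≤
      2 * ∫⁻ η, ENNReal.ofReal (weight (stdVec 0) η)⁻¹ := by
  have hms : MeasurableSet {ζ : E3 | 4 * ‖ξ - ζ‖ < ‖ζ‖} :=
    measurableSet_lt (by fun_prop) (by fun_prop)
  calc _ ≤ ∫⁻ ζ in {ζ | 4 * ‖ξ - ζ‖ < ‖ζ‖}, 2 * ENNReal.ofReal (weight (dir ξ) (ξ - ζ))⁻¹ := by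
        refine setLIntegral_mono' hms fun ζ hζ => ?_
        have h2 : (2 : ℝ≥0∞) = ENNReal.ofReal 2 := by norm_num
        refine le_of_le_of_eq (ENNReal.ofReal_le_ofReal ?_) (by
          rw [ENNReal.ofReal_mul (p := 2) (q := (weight (dir ξ) (ξ - ζ))⁻¹) (by norm_num), ← h2])
        have h3 := weight_dir_le (ξ := ξ) (ζ := ζ) hζ
        have p1 := weight_pos (dir ξ) (ξ - ζ)
        have p2 := weight_pos (dir ζ) (ξ - ζ)
        rw [← div_eq_mul_inv, le_div_iff₀ p1, ← div_eq_inv_mul, div_le_iff₀ p2]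
        exact h3
    _ ≤ ∫⁻ ζ, 2 * ENNReal.ofReal (weight (dir ξ) (ξ - ζ))⁻¹ := setLIntegral_le_lintegral _ _
    _ = 2 * ∫⁻ η, ENNReal.ofReal (weight (dir ξ) η)⁻¹ := by
        rw [lintegral_const_mul' _ _ (by norm_num)]
        congr 1
        exact lintegral_sub_left_eq_self (fun η => ENNReal.ofReal (weight (dir ξ) η)⁻¹) ξ
    _ = _ := by rw [lintegral_inv_weight (by simp)]

/-! ### Plancherel's identity for modulated functions -/

theorem memLp_fourierChar_smul {u : E3 → ℂ} (hu : MemLp u 2 volume) (ζ : E3) :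
    MemLp (fun x => Real.fourierChar (inner ℝ x ζ) • u x) 2 volume := by
  refine hu.of_le ?_ (.of_forall fun x => by simp)
  have : Continuous fun x : E3 => (Real.fourierChar (inner ℝ x ζ) : ℂ) := by fun_prop
  exact this.aestronglyMeasurable.mul hu.1

theorem memLp_translate {u : E3 → ℂ} (hu : MemLp u 2 volume) (ζ : E3) :
    MemLp (fun x => u (x - ζ)) 2 volume :=
  hu.comp_measurePreserving (measurePreserving_sub_right volume ζ)

/-- Translation on the Fourier side is modulation. -/
theorem fourierInv_compSubConstCLM_fourier (f : 𝓢(E3, ℂ)) (ζ x : E3) :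
    (𝓕⁻ ((𝓕 f).compSubConstCLM ℂ (-ζ))) x = Real.fourierChar (-inner ℝ x ζ) • f x := by
  have hf : f x = (𝓕⁻ (𝓕 f)) x := by rw [FourierTransform.fourierInv_fourier_eq]
  rw [hf, fourierInv_coe, fourierInv_coe, Real.fourierInv_eq, Real.fourierInv_eq,
    Circle.smul_def, ← integral_smul, ← integral_sub_right_eq_self _ ζ]
  refine integral_congr_ae (.of_forall fun η => ?_)
  dsimp only
  rw [← Circle.smul_def, compSubConstCLM_apply, sub_neg_eq_add, sub_add_cancel, inner_sub_left,
    sub_eq_add_neg, AddChar.map_add_eq_mul, mul_comm, mul_smul, real_inner_comm x ζ]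

theorem integral_conj_mul_fourierChar_smul_toLp (u : L2E3) (f : 𝓢(E3, ℂ)) (ζ : E3) :
    ∫ x, conj (u x) * (Real.fourierChar (-inner ℝ x ζ) • f x) =
      ∫ ξ, conj ((𝓕 u : L2E3) (ξ - ζ)) * (𝓕 f) ξ := by
  have h1 : ∫ x, conj (u x) * (Real.fourierChar (-inner ℝ x ζ) • f x) =
      inner ℂ u ((𝓕⁻ ((𝓕 f).compSubConstCLM ℂ (-ζ))).toLp 2) := by
    rw [L2.inner_def]
    refine integral_congr_ae ?_
    filter_upwards [(𝓕⁻ ((𝓕 f).compSubConstCLM ℂ (-ζ))).coeFn_toLp 2 volume] with x h2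
    rw [h2, RCLike.inner_apply', fourierInv_compSubConstCLM_fourier]
  have h2 : inner ℂ (𝓕 u) (((𝓕 f).compSubConstCLM ℂ (-ζ)).toLp 2) =
      ∫ η, conj ((𝓕 u : L2E3) η) * (𝓕 f) (η + ζ) := by
    rw [L2.inner_def]
    refine integral_congr_ae ?_
    filter_upwards [((𝓕 f).compSubConstCLM ℂ (-ζ)).coeFn_toLp 2 volume] with x h1
    rw [h1, RCLike.inner_apply', compSubConstCLM_apply, sub_neg_eq_add]
  rw [h1, ← Lp.inner_fourier_eq, toLp_fourier_eq, FourierTransform.fourier_fourierInv_eq, h2,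
    ← integral_sub_right_eq_self _ ζ]
  simp only [sub_add_cancel]

/-- Plancherel's identity for a modulated function: modulation becomes translation. -/
theorem integral_conj_mul_fourierChar_smul (u h : L2E3) (ζ : E3) :
    ∫ x, conj (u x) * (Real.fourierChar (-inner ℝ x ζ) • h x) =
      ∫ ξ, conj ((𝓕 u : L2E3) (ξ - ζ)) * (𝓕 h : L2E3) ξ := by
  have m1 := memLp_fourierChar_smul (Lp.memLp u) ζ
  have m2 := memLp_translate (Lp.memLp (𝓕 u : L2E3)) ζ
  have e1 : ∀ h : L2E3, ∫ x, conj (u x) * (Real.fourierChar (-inner ℝ x ζ) • h x) =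
      inner ℂ (m1.toLp _) h := fun h => by
    rw [L2.inner_def]
    refine integral_congr_ae ?_
    filter_upwards [m1.coeFn_toLp] with x hx
    rw [hx, RCLike.inner_apply', Circle.smul_def, Circle.smul_def, AddChar.map_neg_eq_inv,
      Circle.coe_inv_eq_conj]
    simp only [smul_eq_mul, map_mul]
    ring
  have e2 : ∀ g : L2E3, ∫ ξ, conj ((𝓕 u : L2E3) (ξ - ζ)) * g ξ =
      inner ℂ (m2.toLp _) g := fun g => by
    rw [L2.inner_def]
    refine integral_congr_ae ?_
    filter_upwards [m2.coeFn_toLp] with x hx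
    rw [hx, RCLike.inner_apply']
  -- Both sides are inner products of `h` with fixed elements of `L²`, hence continuous in `h`, so
  -- Schwartz functions suffice.
  rw [e1, e2]
  refine DenseRange.induction_on (p := fun h : L2E3 =>
    inner ℂ (m1.toLp _) h = inner ℂ (m2.toLp _) (𝓕 h))
    (SchwartzMap.denseRange_toLpCLM (p := 2) ENNReal.ofNat_ne_top) h ?_ ?_
  · exact isClosed_eq (continuous_const.inner continuous_id)
      (continuous_const.inner (Lp.fourierTransformₗᵢ E3 ℂ).continuous)
  intro f
  rw [toLpCLM_apply, toLp_fourier_eq, ← e1, ← e2]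
  refine Eq.trans (integral_congr_ae ?_) ((integral_conj_mul_fourierChar_smul_toLp u f ζ).trans
    (integral_congr_ae ?_))
  · filter_upwards [f.coeFn_toLp 2 volume] with x h1
    rw [h1]
  · filter_upwards [(𝓕 f).coeFn_toLp 2 volume] with x h1
    rw [h1]

/-! ### `L²` bound for the adjoint -/

variable {K : ℝ≥0∞} {b : E3 → S2 → ℂ}

/-- The Cauchy–Schwarz inequality. -/
theorem sq_lintegral_mul_le {X : Type*} [MeasurableSpace X] {μ : Measure X} {f g : X → ℝ≥0∞}
    (hf : AEMeasurable f μ) (hg : AEMeasurable g μ) :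
    (∫⁻ x, f x * g x ∂μ) ^ 2 ≤ (∫⁻ x, f x ^ 2 ∂μ) * ∫⁻ x, g x ^ 2 ∂μ := by
  have h := ENNReal.lintegral_mul_le_Lp_mul_Lq μ Real.HolderConjugate.two_two hf hg
  have h2 := pow_le_pow_left' h 2
  rw [mul_pow, ← ENNReal.rpow_natCast, ← ENNReal.rpow_natCast, ← ENNReal.rpow_natCast,
    ← ENNReal.rpow_mul, ← ENNReal.rpow_mul] at h2
  norm_num at h2
  simpa using h2

/-- A symbol that is jointly measurable and satisfies the Fourier bounds for every `ω`. -/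
structure GoodSymbol (K : ℝ≥0∞) (b : E3 → S2 → ℂ) : Prop where
  measurable : Measurable (Function.uncurry b)
  bound : ∀ ω, FourierBound K ω (fun x => b x ω)

/-- The adjoint of the operator with symbol `b`, on the frequency side:
`ζ ↦ ∫ conj b(x, ζ/|ζ|) e^{-2πi x·ζ} h(x) dx`. -/
def adjointTransform (b : E3 → S2 → ℂ) (h : L2E3) (ζ : E3) : ℂ :=
  ∫ x, conj (b x (dir ζ)) * (Real.fourierChar (-inner ℝ x ζ) • h x)

theorem FourierBound.memLp {ω : S2} {a : E3 → ℂ} (h : FourierBound K ω a) : MemLp a 2 volume := by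
  obtain ⟨u, hu, -⟩ := h
  exact (memLp_congr_ae hu).1 (Lp.memLp u)

theorem GoodSymbol.integrable (hb : GoodSymbol K b) (h : L2E3) (ζ : E3) :
    Integrable (fun x => conj (b x (dir ζ)) * (Real.fourierChar (-inner ℝ x ζ) • h x)) := by
  have h1 : MemLp (fun x => conj (b x (dir ζ))) 2 volume := (hb.bound (dir ζ)).memLp.star
  have h2 := memLp_fourierChar_smul (Lp.memLp h) (-ζ)
  simp only [inner_neg_right] at h2
  exact h1.integrable_mul h2

theorem GoodSymbol.stronglyMeasurable_adjointTransform (hb : GoodSymbol K b) (h : L2E3) :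
    StronglyMeasurable (adjointTransform b h) := by
  unfold adjointTransform
  refine StronglyMeasurable.integral_prod_right (f := fun ζ x =>
    conj (b x (dir ζ)) * (Real.fourierChar (-inner ℝ x ζ) • h x)) ?_
  refine Measurable.stronglyMeasurable ?_
  have h1 : Measurable fun p : E3 × E3 => b p.2 (dir p.1) :=
    hb.measurable.comp (measurable_snd.prodMk (measurable_dir.comp measurable_fst))
  have h2 : Measurable fun p : E3 × E3 => (Real.fourierChar (-inner ℝ p.2 p.1) : ℂ) :=
    Continuous.measurable (by fun_prop)
  have h3 : Measurable fun p : E3 × E3 => h p.2 :=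
    (Lp.stronglyMeasurable h).measurable.comp measurable_snd
  simp only [Function.uncurry_def, Circle.smul_def, smul_eq_mul]
  exact (Complex.continuous_conj.measurable.comp h1).mul (h2.mul h3)

/-- The part of `∫ |b̂(ξ - ζ)| |ĥ(ξ)| dξ` with `ξ` close to `ζ`, after Cauchy–Schwarz. -/
def nearPart (h : L2E3) (ζ : E3) : ℝ≥0∞ :=
  ∫⁻ ξ in {ξ | 4 * ‖ξ - ζ‖ < ‖ζ‖},
    ENNReal.ofReal (weight (dir ζ) (ξ - ζ))⁻¹ * ‖(𝓕 h : L2E3) ξ‖ₑ ^ 2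

theorem measurable_nearPart_integrand (h : L2E3) : Measurable fun p : E3 × E3 =>
    indicator {p : E3 × E3 | 4 * ‖p.2 - p.1‖ < ‖p.1‖} (fun p =>
      ENNReal.ofReal (weight (dir p.1) (p.2 - p.1))⁻¹ * ‖(𝓕 h : L2E3) p.2‖ₑ ^ 2) p := by
  have hS : MeasurableSet {p : E3 × E3 | 4 * ‖p.2 - p.1‖ < ‖p.1‖} :=
    measurableSet_lt (by fun_prop) (by fun_prop)
  have h1 : Measurable fun p : E3 × E3 => ((dir p.1 : E3), p.2 - p.1) :=
    (measurable_subtype_coe.comp (measurable_dir.comp measurable_fst)).prodMk (by fun_prop)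
  have h2 : Measurable fun p : E3 × E3 => ENNReal.ofReal (weight (dir p.1) (p.2 - p.1))⁻¹ :=
    (measurable_weight.comp h1).inv.ennreal_ofReal
  have h3 : Measurable fun p : E3 × E3 => ‖(𝓕 h : L2E3) p.2‖ₑ ^ 2 :=
    ((Lp.stronglyMeasurable _).measurable.comp measurable_snd).enorm.pow_const 2
  exact (h2.mul h3).indicator hS

theorem nearPart_eq (h : L2E3) (ζ : E3) : nearPart h ζ =
    ∫⁻ ξ, indicator {p : E3 × E3 | 4 * ‖p.2 - p.1‖ < ‖p.1‖} (fun p =>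
      ENNReal.ofReal (weight (dir p.1) (p.2 - p.1))⁻¹ * ‖(𝓕 h : L2E3) p.2‖ₑ ^ 2) (ζ, ξ) := by
  have hS : MeasurableSet {ξ : E3 | 4 * ‖ξ - ζ‖ < ‖ζ‖} :=
    measurableSet_lt (by fun_prop) (by fun_prop)
  rw [nearPart, ← lintegral_indicator hS]
  rfl

theorem measurable_nearPart (h : L2E3) : Measurable (nearPart h) := by
  rw [funext (nearPart_eq h)]
  exact (measurable_nearPart_integrand h).lintegral_prod_right'

/-- The constant of the Schur test near the diagonal. -/
def schurConst : ℝ≥0∞ := 2 * ∫⁻ η, ENNReal.ofReal (weight (stdVec 0) η)⁻¹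

theorem schurConst_ne_top : schurConst ≠ ⊤ :=
  ENNReal.mul_ne_top (by norm_num) lintegral_inv_weight_stdVec_lt_top.ne

/-- Integrating in `ζ` first gives the Schur integral of the inverse weight. -/
theorem lintegral_nearPart_le (h : L2E3) : ∫⁻ ζ, nearPart h ζ ≤ schurConst * ‖h‖ₑ ^ 2 := by
  simp_rw [nearPart_eq]
  rw [lintegral_lintegral_swap (f := fun ζ ξ => indicator {p : E3 × E3 | 4 * ‖p.2 - p.1‖ < ‖p.1‖}
      (fun p => ENNReal.ofReal (weight (dir p.1) (p.2 - p.1))⁻¹ * ‖(𝓕 h : L2E3) p.2‖ₑ ^ 2) (ζ, ξ))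
      (measurable_nearPart_integrand h).aemeasurable,
    ← lintegral_enorm_sq_fourier, ← lintegral_const_mul' _ _ schurConst_ne_top]
  refine lintegral_mono fun ξ => ?_
  have hS : MeasurableSet {ζ : E3 | 4 * ‖ξ - ζ‖ < ‖ζ‖} :=
    measurableSet_lt (by fun_prop) (by fun_prop)
  have : ∀ ζ, indicator {p : E3 × E3 | 4 * ‖p.2 - p.1‖ < ‖p.1‖} (fun p =>
      ENNReal.ofReal (weight (dir p.1) (p.2 - p.1))⁻¹ * ‖(𝓕 h : L2E3) p.2‖ₑ ^ 2) (ζ, ξ) =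
      indicator {ζ : E3 | 4 * ‖ξ - ζ‖ < ‖ζ‖} (fun ζ =>
      ENNReal.ofReal (weight (dir ζ) (ξ - ζ))⁻¹ * ‖(𝓕 h : L2E3) ξ‖ₑ ^ 2) ζ := fun ζ => rfl
  simp_rw [this]
  rw [lintegral_indicator hS, lintegral_mul_const' _ _ (by simp)]
  exact mul_le_mul_left (lintegral_inv_weight_dir_le ξ) _

theorem add_sq_le_two_mul (x y : ℝ≥0∞) : (x + y) ^ 2 ≤ 2 * x ^ 2 + 2 * y ^ 2 := by
  have := ENNReal.rpow_add_le_mul_rpow_add_rpow x y (p := 2) (by norm_num)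
  norm_num [mul_add] at this
  exact this

theorem mul_eq_sqrt_mul_mul_inv_sqrt_mul {w : ℝ} (hw : 0 < w) (x y : ℝ≥0∞) :
    x * y = (ENNReal.ofReal √w * x) * (ENNReal.ofReal (√w)⁻¹ * y) := by
  rw [mul_mul_mul_comm, ← ENNReal.ofReal_mul (Real.sqrt_nonneg _),
    mul_inv_cancel₀ (Real.sqrt_pos.2 hw).ne', ENNReal.ofReal_one, one_mul]

theorem sq_ofReal_sqrt_mul {w : ℝ} (hw : 0 < w) (x : ℝ≥0∞) :
    (ENNReal.ofReal √w * x) ^ 2 = ENNReal.ofReal w * x ^ 2 := by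
  rw [mul_pow, ← ENNReal.ofReal_pow (Real.sqrt_nonneg _), Real.sq_sqrt hw.le]

theorem sq_ofReal_inv_sqrt_mul {w : ℝ} (hw : 0 < w) (x : ℝ≥0∞) :
    (ENNReal.ofReal (√w)⁻¹ * x) ^ 2 = ENNReal.ofReal w⁻¹ * x ^ 2 := by
  rw [mul_pow, ← ENNReal.ofReal_pow (by positivity), inv_pow, Real.sq_sqrt hw.le]

theorem sq_lintegral_near_le (u h : L2E3) (ζ : E3)
    (hw : ∫⁻ ξ, ENNReal.ofReal (weight (dir ζ) ξ) * ‖(𝓕 u : L2E3) ξ‖ₑ ^ 2 ≤ K) :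
    (∫⁻ ξ in {ξ | 4 * ‖ξ - ζ‖ < ‖ζ‖}, ‖(𝓕 u : L2E3) (ξ - ζ)‖ₑ * ‖(𝓕 h : L2E3) ξ‖ₑ) ^ 2 ≤
      K * nearPart h ζ := by
  have mu : Measurable fun ξ => ‖(𝓕 u : L2E3) (ξ - ζ)‖ₑ :=
    ((Lp.stronglyMeasurable _).measurable.comp (measurable_sub_const ζ)).enorm
  have mh : Measurable fun ξ => ‖(𝓕 h : L2E3) ξ‖ₑ := (Lp.stronglyMeasurable _).measurable.enorm
  have mw : Measurable fun ξ => weight (dir ζ) (ξ - ζ) := by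
    unfold weight perpPart
    exact Continuous.measurable (by fun_prop)
  have e := fun ξ => mul_eq_sqrt_mul_mul_inv_sqrt_mul (weight_pos (dir ζ) (ξ - ζ))
    ‖(𝓕 u : L2E3) (ξ - ζ)‖ₑ ‖(𝓕 h : L2E3) ξ‖ₑ
  have e1 := fun ξ => sq_ofReal_sqrt_mul (weight_pos (dir ζ) (ξ - ζ)) ‖(𝓕 u : L2E3) (ξ - ζ)‖ₑ
  have e2 := fun ξ => sq_ofReal_inv_sqrt_mul (weight_pos (dir ζ) (ξ - ζ)) ‖(𝓕 h : L2E3) ξ‖ₑ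
  rw [lintegral_congr e]
  have m1 : Measurable fun ξ =>
      ENNReal.ofReal √(weight (dir ζ) (ξ - ζ)) * ‖(𝓕 u : L2E3) (ξ - ζ)‖ₑ :=
    mw.sqrt.ennreal_ofReal.mul mu
  have m2 : Measurable fun ξ =>
      ENNReal.ofReal (√(weight (dir ζ) (ξ - ζ)))⁻¹ * ‖(𝓕 h : L2E3) ξ‖ₑ :=
    mw.sqrt.inv.ennreal_ofReal.mul mh
  refine (sq_lintegral_mul_le m1.aemeasurable m2.aemeasurable).trans ?_
  rw [lintegral_congr e1, lintegral_congr e2]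
  refine mul_le_mul' ?_ le_rfl
  refine (setLIntegral_le_lintegral _ _).trans (le_trans (le_of_eq ?_) hw)
  exact lintegral_sub_right_eq_self
    (fun ξ => ENNReal.ofReal (weight (dir ζ) ξ) * ‖(𝓕 u : L2E3) ξ‖ₑ ^ 2) ζ

theorem sq_lintegral_far_le (u h : L2E3) (ζ : E3) :
    (∫⁻ ξ in {ξ | 4 * ‖ξ - ζ‖ < ‖ζ‖}ᶜ, ‖(𝓕 u : L2E3) (ξ - ζ)‖ₑ * ‖(𝓕 h : L2E3) ξ‖ₑ) ^ 2 ≤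
      (∫⁻ η in {η : E3 | ‖ζ‖ ≤ 4 * ‖η‖}, ‖(𝓕 u : L2E3) η‖ₑ ^ 2) * ‖h‖ₑ ^ 2 := by
  have mu : Measurable fun ξ => ‖(𝓕 u : L2E3) (ξ - ζ)‖ₑ :=
    ((Lp.stronglyMeasurable _).measurable.comp (measurable_sub_const ζ)).enorm
  have mh : Measurable fun ξ => ‖(𝓕 h : L2E3) ξ‖ₑ := (Lp.stronglyMeasurable _).measurable.enorm
  have hS : MeasurableSet {ξ : E3 | 4 * ‖ξ - ζ‖ < ‖ζ‖} :=
    measurableSet_lt (by fun_prop) (by fun_prop)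
  have hT : MeasurableSet {η : E3 | ‖ζ‖ ≤ 4 * ‖η‖} :=
    measurableSet_le (by fun_prop) (by fun_prop)
  refine (sq_lintegral_mul_le mu.aemeasurable mh.aemeasurable).trans ?_
  refine mul_le_mul' (le_of_eq ?_)
    ((setLIntegral_le_lintegral _ _).trans_eq (lintegral_enorm_sq_fourier h))
  rw [← lintegral_indicator hS.compl, ← lintegral_indicator hT,
    ← lintegral_sub_right_eq_self (indicator {η : E3 | ‖ζ‖ ≤ 4 * ‖η‖} _) ζ]
  refine lintegral_congr fun ξ => ?_
  simp only [indicator, mem_compl_iff, mem_ofPred_eq, not_lt]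

/-- The pointwise bound that separates the near-diagonal and the far contributions. Only the
value `ω = ζ/|ζ|` of the angle occurs, so `u` may depend on it in a non-measurable way. -/
theorem enorm_sq_adjointTransform_le (h : L2E3) (ζ : E3) {u : L2E3}
    (hu : u =ᵐ[volume] fun x => b x (dir ζ))
    (hw : ∫⁻ ξ, ENNReal.ofReal (weight (dir ζ) ξ) * ‖(𝓕 u : L2E3) ξ‖ₑ ^ 2 ≤ K) :
    ‖adjointTransform b h ζ‖ₑ ^ 2 ≤ 2 * (K * nearPart h ζ) +
      2 * ((∫⁻ η in {η : E3 | ‖ζ‖ ≤ 4 * ‖η‖}, ‖(𝓕 u : L2E3) η‖ₑ ^ 2) * ‖h‖ₑ ^ 2) := by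
  have e1 : adjointTransform b h ζ = ∫ ξ, conj ((𝓕 u : L2E3) (ξ - ζ)) * (𝓕 h : L2E3) ξ := by
    rw [← integral_conj_mul_fourierChar_smul, adjointTransform]
    refine integral_congr_ae ?_
    filter_upwards [hu] with x hx
    rw [hx]
  have hS : MeasurableSet {ξ : E3 | 4 * ‖ξ - ζ‖ < ‖ζ‖} :=
    measurableSet_lt (by fun_prop) (by fun_prop)
  have e2 : ‖adjointTransform b h ζ‖ₑ ≤ ∫⁻ ξ, ‖(𝓕 u : L2E3) (ξ - ζ)‖ₑ * ‖(𝓕 h : L2E3) ξ‖ₑ := by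
    rw [e1]
    refine (enorm_integral_le_lintegral_enorm _).trans_eq (lintegral_congr fun ξ => ?_)
    rw [enorm_mul, RCLike.enorm_conj]
  rw [← lintegral_add_compl _ hS] at e2
  exact (pow_le_pow_left' e2 2).trans ((add_sq_le_two_mul _ _).trans (add_le_add
    (mul_le_mul_right (sq_lintegral_near_le u h ζ hw) _)
    (mul_le_mul_right (sq_lintegral_far_le u h ζ) _)))

/-- The Hilbert–Schmidt bound away from the diagonal, for a fixed direction. -/
theorem lintegral_radial_tail_le {v : E3 → ℂ} (hv : Measurable v) :
    ∫⁻ l in Ioi (0 : ℝ), ENNReal.ofReal (l ^ 2) *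
      ∫⁻ η in {η : E3 | l ≤ 4 * ‖η‖}, ‖v η‖ₑ ^ 2 ≤
    64 * ∫⁻ η : E3, ENNReal.ofReal (‖η‖ ^ 3) * ‖v η‖ₑ ^ 2 := by
  have hT : ∀ l : ℝ, MeasurableSet {η : E3 | l ≤ 4 * ‖η‖} := fun l =>
    measurableSet_le (by fun_prop) (by fun_prop)
  have e1 : ∀ l : ℝ, ENNReal.ofReal (l ^ 2) * ∫⁻ η in {η : E3 | l ≤ 4 * ‖η‖}, ‖v η‖ₑ ^ 2 =
      ∫⁻ η, indicator {p : ℝ × E3 | p.1 ≤ 4 * ‖p.2‖}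
        (fun p => ENNReal.ofReal (p.1 ^ 2) * ‖v p.2‖ₑ ^ 2) (l, η) := fun l => by
    rw [← lintegral_const_mul' _ _ (by simp), ← lintegral_indicator (hT l)]
    rfl
  have hm : Measurable (indicator {p : ℝ × E3 | p.1 ≤ 4 * ‖p.2‖}
        (fun p => ENNReal.ofReal (p.1 ^ 2) * ‖v p.2‖ₑ ^ 2)) := by
    refine Measurable.indicator ?_ (measurableSet_le (by fun_prop) (by fun_prop))
    exact (measurable_fst.pow_const 2).ennreal_ofReal.mul
      ((hv.comp measurable_snd).enorm.pow_const 2)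
  simp_rw [e1]
  rw [lintegral_lintegral_swap (f := fun l η => indicator {p : ℝ × E3 | p.1 ≤ 4 * ‖p.2‖}
      (fun p => ENNReal.ofReal (p.1 ^ 2) * ‖v p.2‖ₑ ^ 2) (l, η)) hm.aemeasurable, ← lintegral_const_mul' _ _ (by norm_num)]
  refine lintegral_mono fun η => ?_
  calc ∫⁻ l in Ioi (0 : ℝ), indicator {p : ℝ × E3 | p.1 ≤ 4 * ‖p.2‖}
        (fun p => ENNReal.ofReal (p.1 ^ 2) * ‖v p.2‖ₑ ^ 2) (l, η)
      ≤ ∫⁻ l in Ioi (0 : ℝ), indicator (Iic (4 * ‖η‖))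
        (fun _ => ENNReal.ofReal ((4 * ‖η‖) ^ 2) * ‖v η‖ₑ ^ 2) l := by
        refine setLIntegral_mono' measurableSet_Ioi fun l hl => ?_
        by_cases h : l ≤ 4 * ‖η‖
        · rw [indicator_of_mem (by exact h), indicator_of_mem (by exact h)]
          have : 0 ≤ l := le_of_lt hl
          gcongr
        · rw [indicator_of_notMem (by exact h)]; exact zero_le
    _ = ENNReal.ofReal ((4 * ‖η‖) ^ 2) * ‖v η‖ₑ ^ 2 * ENNReal.ofReal (4 * ‖η‖) := by
        rw [lintegral_indicator measurableSet_Iic, setLIntegral_const,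
          Measure.restrict_apply measurableSet_Iic, Iic_inter_Ioi, Real.volume_Ioc, sub_zero]
    _ = 64 * (ENNReal.ofReal (‖η‖ ^ 3) * ‖v η‖ₑ ^ 2) := by
        have : (4 * ‖η‖) ^ 2 * (4 * ‖η‖) = 64 * ‖η‖ ^ 3 := by ring
        rw [mul_right_comm, ← ENNReal.ofReal_mul (by positivity), this,
          ENNReal.ofReal_mul (by norm_num), mul_assoc]
        norm_num

/-- The constant in the `L²` bound of `adjointTransform`. -/
def operatorConst : ℝ≥0∞ := 2 * schurConst + 128 * surfS2 univ

theorem operatorConst_ne_top : operatorConst ≠ ⊤ := by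
  refine ENNReal.add_ne_top.2 ⟨ENNReal.mul_ne_top (by norm_num) schurConst_ne_top,
    ENNReal.mul_ne_top (by norm_num) (measure_ne_top _ _)⟩

/-- The `L²` bound for the adjoint. In polar coordinates the far contribution is integrated in the
radius for each fixed direction, which bounds it by a constant. -/
theorem GoodSymbol.lintegral_enorm_sq_adjointTransform_le (hK : K ≠ ⊤) (hb : GoodSymbol K b)
    (h : L2E3) :
    ∫⁻ ζ, ‖adjointTransform b h ζ‖ₑ ^ 2 ≤ operatorConst * K * ‖h‖ₑ ^ 2 := by
  have hm := (hb.stronglyMeasurable_adjointTransform h).measurable.enorm.pow_const 2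
  have hn := measurable_nearPart h
  have hpol : Measurable fun p : S2 × ℝ => ENNReal.ofReal (p.2 ^ 2) *
      nearPart h (p.2 • (p.1 : E3)) :=
    (measurable_snd.pow_const 2).ennreal_ofReal.mul (hn.comp measurePreserving_polar.measurable)
  have hfin : ‖h‖ₑ ^ 2 ≠ ⊤ := by simp
  rw [lintegral_polar hm]
  calc _ ≤ ∫⁻ ω : S2, (2 * K * (∫⁻ l in Ioi (0 : ℝ), ENNReal.ofReal (l ^ 2) *
          nearPart h (l • (ω : E3))) + 128 * K * ‖h‖ₑ ^ 2) ∂surfS2 := by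
        refine lintegral_mono fun ω => ?_
        obtain ⟨u, hu, hw, h3⟩ := hb.bound ω
        have hle : ∀ l ∈ Ioi (0 : ℝ), ENNReal.ofReal (l ^ 2) *
            ‖adjointTransform b h (l • (ω : E3))‖ₑ ^ 2 ≤
            2 * K * (ENNReal.ofReal (l ^ 2) * nearPart h (l • (ω : E3))) +
            2 * ‖h‖ₑ ^ 2 * (ENNReal.ofReal (l ^ 2) *
              ∫⁻ η in {η : E3 | l ≤ 4 * ‖η‖}, ‖(𝓕 u : L2E3) η‖ₑ ^ 2) := fun l hl => by
          have hd := dir_smul ω hl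
          have hnorm : ‖l • (ω : E3)‖ = l := by
            rw [norm_smul, Real.norm_eq_abs, abs_of_pos hl]; simp
          have := enorm_sq_adjointTransform_le (b := b) (K := K) h (l • (ω : E3)) (u := u)
            (by rw [hd]; exact hu) (by rw [hd]; exact hw)
          rw [hnorm] at this
          refine (mul_le_mul_right this _).trans_eq (by ring)
        refine (setLIntegral_mono' measurableSet_Ioi hle).trans ?_
        have hml : Measurable fun l : ℝ => ENNReal.ofReal (l ^ 2) * nearPart h (l • (ω : E3)) :=
          hpol.comp measurable_prodMk_left
        rw [lintegral_add_left (hml.const_mul _),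
          lintegral_const_mul' _ _ (ENNReal.mul_ne_top (by norm_num) hK),
          lintegral_const_mul' _ _ (ENNReal.mul_ne_top (by norm_num) hfin)]
        refine add_le_add le_rfl ?_
        calc _ ≤ 2 * ‖h‖ₑ ^ 2 * (64 * K) := by
              refine mul_le_mul_right ?_ _
              exact (lintegral_radial_tail_le (Lp.stronglyMeasurable _).measurable).trans
                (mul_le_mul_right h3 _)
          _ = _ := by ring
    _ = 2 * K * (∫⁻ ζ, nearPart h ζ) + 128 * K * ‖h‖ₑ ^ 2 * surfS2 univ := by
        rw [lintegral_add_right _ measurable_const,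
          lintegral_const_mul' _ _ (ENNReal.mul_ne_top (by norm_num) hK), lintegral_const,
          ← lintegral_polar hn]
    _ ≤ 2 * K * (schurConst * ‖h‖ₑ ^ 2) + 128 * K * ‖h‖ₑ ^ 2 * surfS2 univ := by
        gcongr; exact lintegral_nearPart_le h
    _ = _ := by rw [operatorConst]; ring

theorem GoodSymbol.memLp_adjointTransform (hK : K ≠ ⊤) (hb : GoodSymbol K b) (h : L2E3) :
    MemLp (adjointTransform b h) 2 volume := by
  refine ⟨(hb.stronglyMeasurable_adjointTransform h).aestronglyMeasurable, ?_⟩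
  rw [eLpNorm_lt_top_iff_lintegral_rpow_enorm_lt_top (by norm_num) (by norm_num)]
  norm_num
  refine (hb.lintegral_enorm_sq_adjointTransform_le hK h).trans_lt ?_
  exact ENNReal.mul_lt_top (ENNReal.mul_lt_top operatorConst_ne_top.lt_top hK.lt_top) (by simp)

/-- `adjointTransform` as a bounded operator. -/
theorem GoodSymbol.exists_adjointCLM (hK : K ≠ ⊤) (hb : GoodSymbol K b) :
    ∃ A : L2E3 →L[ℂ] L2E3, (∀ h, A h =ᵐ[volume] adjointTransform b h) ∧
      ‖A‖ ≤ √(operatorConst * K).toReal := by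
  have hm := hb.memLp_adjointTransform hK
  let T : L2E3 →ₗ[ℂ] L2E3 :=
    { toFun := fun h => (hm h).toLp _
      map_add' := fun h k => by
        rw [← MemLp.toLp_add]
        refine MemLp.toLp_congr _ _ (.of_forall fun ζ => ?_)
        rw [Pi.add_apply, adjointTransform, adjointTransform, adjointTransform,
          ← integral_add (hb.integrable h ζ) (hb.integrable k ζ)]
        refine integral_congr_ae ?_
        filter_upwards [Lp.coeFn_add h k] with x hx
        rw [hx, Pi.add_apply, smul_add, mul_add]
      map_smul' := fun c h => by
        rw [RingHom.id_apply, ← MemLp.toLp_const_smul]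
        refine MemLp.toLp_congr _ _ (.of_forall fun ζ => ?_)
        rw [Pi.smul_apply, adjointTransform, adjointTransform, ← integral_smul]
        refine integral_congr_ae ?_
        filter_upwards [Lp.coeFn_smul c h] with x hx
        rw [hx, Pi.smul_apply, smul_comm, mul_smul_comm] }
  have hT : ∀ h, ‖T h‖ ≤ √(operatorConst * K).toReal * ‖h‖ := fun h => by
    have h1 : ‖T h‖ₑ ^ 2 ≤ operatorConst * K * ‖h‖ₑ ^ 2 := by
      rw [← lintegral_enorm_sq_coe_Lp]
      refine le_trans (le_of_eq (lintegral_congr_ae ?_))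
        (hb.lintegral_enorm_sq_adjointTransform_le hK h)
      filter_upwards [(hm h).coeFn_toLp] with x hx
      rw [← hx]; rfl
    have h2 := ENNReal.toReal_mono (ENNReal.mul_ne_top (ENNReal.mul_ne_top operatorConst_ne_top hK)
      (by simp)) h1
    rw [ENNReal.toReal_mul, ENNReal.toReal_pow, ENNReal.toReal_pow, toReal_enorm, toReal_enorm] at h2
    rw [← Real.sqrt_sq (norm_nonneg h), ← Real.sqrt_mul ENNReal.toReal_nonneg]
    exact Real.le_sqrt_of_sq_le h2
  exact ⟨T.mkContinuous _ hT, fun h => (hm h).coeFn_toLp,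
    T.mkContinuous_norm_le (Real.sqrt_nonneg _) hT⟩

/-! ### The operator in Cartesian frequency coordinates -/

/-- The integrand of the operator in Cartesian frequency coordinates,
`e^{2πi x·ζ} b(x, ζ/|ζ|) f̂(ζ)`. -/
def cartesianIntegrand (b : E3 → S2 → ℂ) (f : L2E3) (x ζ : E3) : ℂ :=
  Real.fourierChar (inner ℝ x ζ) • (b x (dir ζ) * (𝓕 f : L2E3) ζ)

theorem measurable_cartesianIntegrand (hb : Measurable (Function.uncurry b)) (f : L2E3) :
    Measurable (Function.uncurry (cartesianIntegrand b f)) := by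
  have h1 : Measurable fun p : E3 × E3 => b p.1 (dir p.2) :=
    hb.comp (measurable_fst.prodMk (measurable_dir.comp measurable_snd))
  have h2 : Measurable fun p : E3 × E3 => (Real.fourierChar (inner ℝ p.1 p.2) : ℂ) :=
    Continuous.measurable (by fun_prop)
  have h3 : Measurable fun p : E3 × E3 => (𝓕 f : L2E3) p.2 :=
    (Lp.stronglyMeasurable _).measurable.comp measurable_snd
  exact h2.mul (h1.mul h3)

theorem enorm_cartesianIntegrand (f : L2E3) (x ζ : E3) :
    ‖cartesianIntegrand b f x ζ‖ₑ = ‖b x (dir ζ)‖ₑ * ‖(𝓕 f : L2E3) ζ‖ₑ := by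
  rw [cartesianIntegrand, Circle.smul_def, enorm_smul, enorm_mul, ← ofReal_norm, Circle.norm_coe,
    ENNReal.ofReal_one, one_mul]

theorem prod_radialMeasure : surfS2.prod radialMeasure =
    (surfS2.prod (volume.restrict (Ioi (0 : ℝ)))).withDensity
      fun p => ENNReal.ofReal (p.2 ^ 2) :=
  prod_withDensity_right (by fun_prop)

theorem dir_smul_eq {c : ℝ} (hc : 0 < c) (ζ : E3) : dir (c • ζ) = dir ζ := by
  by_cases h : ζ = 0
  · simp [h]
  · apply Subtype.ext
    rw [coe_dir (smul_ne_zero hc.ne' h), coe_dir h, norm_smul, smul_smul, Real.norm_eq_abs,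
      abs_of_pos hc]
    congr 1
    field_simp

theorem psdoIntegrand_eq (f : L2E3) (x : E3) (ω : S2) {l : ℝ} (hl : 0 < l) :
    psdoIntegrand b f x ω l = (ENNReal.ofReal (l ^ 2)).toReal •
      cartesianIntegrand b f x ((2 * Real.pi)⁻¹ • (l • (ω : E3))) := by
  rw [psdoIntegrand, cartesianIntegrand, dir_smul_eq (by positivity), dir_smul ω hl,
    ENNReal.toReal_ofReal (by positivity), Circle.smul_def, Real.fourierChar_apply,
    inner_smul_right, inner_smul_right, fourierAng, Complex.real_smul, smul_eq_mul]
  have : (2 * Real.pi * ((2 * Real.pi)⁻¹ * (l * inner ℝ x (ω : E3)))) = l * inner ℝ x (ω : E3) := by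
    field_simp
  rw [this, mul_comm Complex.I]
  ring

theorem psdoIntegrand_ae_eq (f : L2E3) (x : E3) :
    (fun p : S2 × ℝ => psdoIntegrand b f x p.1 p.2)
      =ᵐ[surfS2.prod (volume.restrict (Ioi (0 : ℝ)))]
    fun p => (ENNReal.ofReal (p.2 ^ 2)).toReal •
      cartesianIntegrand b f x ((2 * Real.pi)⁻¹ • (p.2 • (p.1 : E3))) := by
  have h : ∀ᵐ p : S2 × ℝ ∂(surfS2.prod (volume.restrict (Ioi (0 : ℝ)))), 0 < p.2 :=
    Measure.quasiMeasurePreserving_snd.ae (ae_restrict_mem measurableSet_Ioi)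
  filter_upwards [h] with p hp
  exact psdoIntegrand_eq f x p.1 hp

theorem measurable_cartesianIntegrand_smul (hb : Measurable (Function.uncurry b)) (f : L2E3)
    (x : E3) : Measurable fun ζ : E3 => cartesianIntegrand b f x ((2 * Real.pi)⁻¹ • ζ) := by
  have h1 : Measurable (cartesianIntegrand b f x) :=
    (measurable_cartesianIntegrand hb f).of_uncurry_left
  have h2 : Measurable fun ζ : E3 => (2 * Real.pi)⁻¹ • ζ := Continuous.measurable (by fun_prop)
  exact h1.comp h2

/-- Absolute convergence in polar coordinates is integrability in Cartesian coordinates. -/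
theorem psdoConverges_iff (hb : Measurable (Function.uncurry b)) (f : L2E3) (x : E3) :
    PsdoConverges b f x ↔ Integrable (cartesianIntegrand b f x) := by
  have hm2 := measurable_cartesianIntegrand_smul hb f x
  rw [← integrable_comp_smul_iff volume (cartesianIntegrand b f x)
      (inv_ne_zero Real.two_pi_pos.ne'),
    ← measurePreserving_polar.integrable_comp hm2.aestronglyMeasurable, prod_radialMeasure,
    integrable_withDensity_iff_integrable_smul' (by fun_prop) (by simp), PsdoConverges,
    integrable_congr (psdoIntegrand_ae_eq f x)]
  rfl

/-- The factor `(2π)³` comes from the substitution `λω = 2πζ`. -/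
theorem psdo_eq (hb : Measurable (Function.uncurry b)) (f : L2E3) {x : E3}
    (h : PsdoConverges b f x) :
    psdo b f x = ((2 * Real.pi) ^ 3 : ℝ) • ∫ ζ, cartesianIntegrand b f x ζ := by
  have hm2 := measurable_cartesianIntegrand_smul hb f x
  have h1 : ∫ ζ : E3, cartesianIntegrand b f x ((2 * Real.pi)⁻¹ • ζ) =
      ((2 * Real.pi) ^ 3 : ℝ) • ∫ ζ, cartesianIntegrand b f x ζ := by
    rw [Measure.integral_comp_smul, finrank_euclideanSpace_fin, ← inv_pow, inv_inv,
      abs_of_pos (by positivity)]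
  have h2 := integral_map (μ := surfS2.prod radialMeasure) measurePreserving_polar.measurable.aemeasurable
    (f := fun ζ : E3 => cartesianIntegrand b f x ((2 * Real.pi)⁻¹ • ζ))
    (hm2.aestronglyMeasurable)
  rw [measurePreserving_polar.map_eq, prod_radialMeasure,
    integral_withDensity_eq_integral_toReal_smul (by fun_prop) (by simp)] at h2
  rw [← h1, h2, psdo, ← integral_prod _ h]
  exact integral_congr_ae (psdoIntegrand_ae_eq f x)

/-! ### Identification of the operator with the integral -/

theorem GoodSymbol.lintegral_enorm_sq_le (hb : GoodSymbol K b) (ω : S2) :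
    ∫⁻ x, ‖b x ω‖ₑ ^ 2 ≤ K := by
  obtain ⟨u, hu, hw, -⟩ := hb.bound ω
  calc ∫⁻ x, ‖b x ω‖ₑ ^ 2 = ∫⁻ x, ‖u x‖ₑ ^ 2 :=
        lintegral_congr_ae (by filter_upwards [hu] with x hx; rw [hx])
    _ = ∫⁻ ξ, ‖(𝓕 u : L2E3) ξ‖ₑ ^ 2 := by
        rw [lintegral_enorm_sq_coe_Lp, lintegral_enorm_sq_fourier]
    _ ≤ ∫⁻ ξ, ENNReal.ofReal (weight ω ξ) * ‖(𝓕 u : L2E3) ξ‖ₑ ^ 2 := by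
        refine lintegral_mono fun ξ => le_mul_of_one_le_left (by simp) ?_
        rw [ENNReal.one_le_ofReal, weight]
        nlinarith [sq_nonneg ‖ξ‖, sq_nonneg ‖perpPart ω ξ‖,
          mul_nonneg (sq_nonneg ‖ξ‖) (sq_nonneg ‖perpPart ω ξ‖)]
    _ ≤ K := hw

/-- On a ball `b(·, ω)` is integrable uniformly in `ω`, so `|b(x, ζ/|ζ|)| |f̂(ζ)|` is integrable over
the ball times `ℝ³` as soon as `f̂` is integrable. -/
theorem GoodSymbol.ae_integrable_cartesianIntegrand (hK : K ≠ ⊤) (hb : GoodSymbol K b)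
    (f : L2E3) (hf : Integrable (𝓕 f : L2E3)) :
    ∀ᵐ x, Integrable (cartesianIntegrand b f x) := by
  have hm := measurable_cartesianIntegrand hb.measurable f
  suffices H : ∀ n : ℕ, ∀ᵐ x ∂(volume.restrict (closedBall (0 : E3) n)),
      ∫⁻ ζ, ‖cartesianIntegrand b f x ζ‖ₑ < ⊤ by
    have H2 : ∀ n : ℕ, ∀ᵐ x : E3, x ∈ closedBall (0 : E3) n →
      ∫⁻ ζ, ‖cartesianIntegrand b f x ζ‖ₑ < ⊤ := fun n =>
        (ae_restrict_iff' measurableSet_closedBall).1 (H n)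
    filter_upwards [ae_all_iff.2 H2] with x hx
    obtain ⟨n, hn⟩ := exists_nat_ge ‖x‖
    exact ⟨(hm.comp measurable_prodMk_left).aestronglyMeasurable, hx n (by simpa using hn)⟩
  intro n
  refine ae_lt_top hm.enorm.lintegral_prod_right' (ne_of_lt ?_)
  rw [lintegral_lintegral_swap hm.enorm.aemeasurable]
  have hV : volume (closedBall (0 : E3) n) ≠ ⊤ := measure_closedBall_lt_top.ne
  have bound : ∀ ζ, ∫⁻ x in closedBall (0 : E3) n, ‖cartesianIntegrand b f x ζ‖ₑ ≤
      (volume (closedBall (0 : E3) n) + K) * ‖(𝓕 f : L2E3) ζ‖ₑ := fun ζ => by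
    simp_rw [enorm_cartesianIntegrand]
    rw [lintegral_mul_const' _ _ (by simp)]
    refine mul_le_mul_left ?_ _
    calc ∫⁻ x in closedBall (0 : E3) n, ‖b x (dir ζ)‖ₑ
        ≤ ∫⁻ x in closedBall (0 : E3) n, (1 + ‖b x (dir ζ)‖ₑ ^ 2) := by
          refine lintegral_mono fun x => ?_
          rcases le_total ‖b x (dir ζ)‖ₑ 1 with h | h
          · exact h.trans le_self_add
          · exact (le_self_pow₀ h (by norm_num)).trans le_add_self
      _ ≤ volume (closedBall (0 : E3) n) + K := by
          rw [lintegral_add_left measurable_const, setLIntegral_one]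
          exact add_le_add le_rfl
            ((setLIntegral_le_lintegral _ _).trans (hb.lintegral_enorm_sq_le _))
  refine (lintegral_mono bound).trans_lt ?_
  rw [lintegral_const_mul' _ _ (ENNReal.add_ne_top.2 ⟨hV, hK⟩)]
  exact ENNReal.mul_lt_top (ENNReal.add_ne_top.2 ⟨hV, hK⟩).lt_top hf.2

/-- Fubini's theorem for `⟨1_S, A^* f̂⟩`, valid when the operator converges absolutely and uniformly
on a set `S` of finite measure. -/
theorem setIntegral_adjoint_eq (hb : GoodSymbol K b) {A : L2E3 →L[ℂ] L2E3}
    (hA : ∀ h, A h =ᵐ[volume] adjointTransform b h) (f : L2E3) {S : Set E3} {c : ℝ≥0∞}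
    (hc : c ≠ ⊤) (hS : MeasurableSet S) (hvol : volume S ≠ ⊤)
    (hSc : ∀ x ∈ S, ∫⁻ ζ, ‖cartesianIntegrand b f x ζ‖ₑ ≤ c) :
    ∫ x in S, (ContinuousLinearMap.adjoint A (𝓕 f) : L2E3) x =
      ∫ x in S, ∫ ζ, cartesianIntegrand b f x ζ := by
  have hm := measurable_cartesianIntegrand hb.measurable f
  have hint : Integrable (Function.uncurry (cartesianIntegrand b f))
      ((volume.restrict S).prod volume) := by
    refine ⟨hm.aestronglyMeasurable, ?_⟩
    rw [hasFiniteIntegral_iff_enorm, lintegral_prod _ hm.enorm.aemeasurable]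
    refine lt_of_le_of_lt (setLIntegral_mono' hS hSc) ?_
    rw [setLIntegral_const]
    exact ENNReal.mul_lt_top hc.lt_top hvol.lt_top
  rw [← L2.inner_indicatorConstLp_one (𝕜 := ℂ) hS hvol, ContinuousLinearMap.adjoint_inner_right,
    L2.inner_def, integral_integral_swap hint]
  refine integral_congr_ae ?_
  filter_upwards [hA (indicatorConstLp 2 hS hvol 1)] with ζ hζ
  rw [hζ, RCLike.inner_apply', adjointTransform, ← integral_conj, ← integral_mul_const,
    ← integral_indicator hS]
  refine integral_congr_ae ?_
  filter_upwards [indicatorConstLp_coeFn (p := 2) (hs := hS) (hμs := hvol) (c := (1 : ℂ))] with x hx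
  rw [hx]
  by_cases hxS : x ∈ S
  · rw [indicator_of_mem hxS, indicator_of_mem hxS, cartesianIntegrand, Circle.smul_def,
      Circle.smul_def, AddChar.map_neg_eq_inv, Circle.coe_inv_eq_conj]
    simp only [smul_eq_mul, map_mul, mul_one, Complex.conj_conj]
    ring
  · rw [indicator_of_notMem hxS, indicator_of_notMem hxS]
    simp

theorem ae_adjoint_eq_integral (hb : GoodSymbol K b) {A : L2E3 →L[ℂ] L2E3}
    (hA : ∀ h, A h =ᵐ[volume] adjointTransform b h) (f : L2E3) :
    ∀ᵐ x, Integrable (cartesianIntegrand b f x) →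
      (ContinuousLinearMap.adjoint A (𝓕 f) : L2E3) x = ∫ ζ, cartesianIntegrand b f x ζ := by
  have hm := measurable_cartesianIntegrand hb.measurable f
  have hml : Measurable fun x => ∫⁻ ζ, ‖cartesianIntegrand b f x ζ‖ₑ :=
    hm.enorm.lintegral_prod_right'
  set g : L2E3 := ContinuousLinearMap.adjoint A (𝓕 f)
  -- Sets of finite measure on which `∫ |b| |f̂| dζ` is bounded; they exhaust the points of convergence.
  set E : ℕ → Set E3 := fun n =>
    closedBall (0 : E3) n ∩ {x | ∫⁻ ζ, ‖cartesianIntegrand b f x ζ‖ₑ ≤ n}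
  have hE : ∀ n, MeasurableSet (E n) := fun n =>
    measurableSet_closedBall.inter (measurableSet_le hml measurable_const)
  have hEv : ∀ n, volume (E n) < ⊤ := fun n =>
    (measure_mono inter_subset_left).trans_lt measure_closedBall_lt_top
  have H : ∀ n, ∀ᵐ x, x ∈ E n → g x = ∫ ζ, cartesianIntegrand b f x ζ := fun n => by
    rw [← ae_restrict_iff' (hE n)]
    have : IsFiniteMeasure (volume.restrict (E n)) := ⟨by simpa using hEv n⟩
    refine Integrable.ae_eq_of_forall_setIntegral_eq _ _ ?_ ?_ fun s hs _ => ?_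
    · exact ((Lp.memLp g).restrict _).integrable (by norm_num)
    · refine Integrable.of_bound
        (hm.stronglyMeasurable.integral_prod_right').aestronglyMeasurable n ?_
      filter_upwards [ae_restrict_mem (hE n)] with x hx
      have h1 := (enorm_integral_le_lintegral_enorm (cartesianIntegrand b f x)
        (μ := volume)).trans hx.2
      rw [← ofReal_norm, ← ENNReal.ofReal_natCast, ENNReal.ofReal_le_ofReal_iff (by simp)] at h1
      exact h1
    · rw [Measure.restrict_restrict hs]
      exact setIntegral_adjoint_eq hb hA f (ENNReal.natCast_ne_top n) (hs.inter (hE n))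
        ((measure_mono inter_subset_right).trans_lt (hEv n)).ne fun x hx => hx.2.2
  filter_upwards [ae_all_iff.2 H] with x hx hint
  obtain ⟨n, hn⟩ := exists_nat_ge ‖x‖
  obtain ⟨m, hm⟩ := ENNReal.exists_nat_gt hint.2.ne
  refine hx (max n m) ⟨?_, ?_⟩
  · rw [mem_closedBall_zero_iff]
    exact hn.trans (by exact_mod_cast le_max_left n m)
  · exact hm.le.trans (by exact_mod_cast le_max_right n m)

theorem integrable_fourier_of_fourierAng {f : L2E3} (h : Integrable (fourierAng f)) :
    Integrable (𝓕 f : L2E3) :=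
  (integrable_comp_smul_iff volume _ (inv_ne_zero Real.two_pi_pos.ne')).1 h

/-- The operator with a good symbol is bounded on `L²(ℝ³)`. -/
theorem GoodSymbol.exists_operator (hK : K ≠ ⊤) (hb : GoodSymbol K b) :
    ∃ B : L2E3 →L[ℂ] L2E3,
      (∀ f : L2E3, Integrable (fourierAng f) volume → ∀ᵐ x : E3, PsdoConverges b f x) ∧
      (∀ f : L2E3, ∀ᵐ x : E3, PsdoConverges b f x → B f x = psdo b f x) ∧
      (∀ f : L2E3, ‖B f‖ ≤ (2 * Real.pi) ^ 3 * √(operatorConst * K).toReal * ‖f‖) := by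
  obtain ⟨A, hA, hAn⟩ := hb.exists_adjointCLM hK
  have hpi : (0 : ℝ) ≤ (2 * Real.pi) ^ 3 := by positivity
  refine ⟨(((2 * Real.pi) ^ 3 : ℝ) : ℂ) • (ContinuousLinearMap.adjoint A ∘L
    (Lp.fourierTransformₗᵢ E3 ℂ).toContinuousLinearEquiv.toContinuousLinearMap), ?_, ?_, ?_⟩
  · intro f hf
    filter_upwards [hb.ae_integrable_cartesianIntegrand hK f
      (integrable_fourier_of_fourierAng hf)] with x hx
    exact (psdoConverges_iff hb.measurable f x).2 hx
  · intro f
    have hsm := Lp.coeFn_smul (((2 * Real.pi) ^ 3 : ℝ) : ℂ)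
      (ContinuousLinearMap.adjoint A (𝓕 f) : L2E3)
    filter_upwards [ae_adjoint_eq_integral hb hA f, hsm] with x hx hs hconv
    rw [psdo_eq hb.measurable f hconv, ← hx ((psdoConverges_iff hb.measurable f x).1 hconv)]
    exact hs
  · intro f
    have h1 : ‖(ContinuousLinearMap.adjoint A (𝓕 f) : L2E3)‖ ≤
        √(operatorConst * K).toReal * ‖f‖ := by
      refine (ContinuousLinearMap.le_opNorm _ _).trans ?_
      rw [Lp.norm_fourier_eq, LinearIsometryEquiv.norm_map]
      gcongr
    calc _ = ‖(((2 * Real.pi) ^ 3 : ℝ) : ℂ) • (ContinuousLinearMap.adjoint A (𝓕 f) : L2E3)‖ := rfl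
      _ ≤ _ := by
        rw [norm_smul, Complex.norm_real, Real.norm_of_nonneg hpi, mul_assoc]
        gcongr

/-! ### Passage to a jointly measurable symbol -/

theorem FourierBound.congr {ω : S2} {a a' : E3 → ℂ} (h : FourierBound K ω a)
    (haa : a =ᵐ[volume] a') : FourierBound K ω a' := by
  obtain ⟨u, hu, h1, h2⟩ := h
  exact ⟨u, hu.trans haa, h1, h2⟩

theorem fourierBound_zero (ω : S2) : FourierBound K ω (fun _ => 0) := by
  have h0 : (𝓕 (0 : L2E3) : L2E3) = 0 := (Lp.fourierTransformₗᵢ E3 ℂ).map_zero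
  have h1 : ∀ w : E3 → ℝ≥0∞, ∫⁻ ξ, w ξ * ‖(𝓕 (0 : L2E3) : L2E3) ξ‖ₑ ^ 2 = 0 := fun w => by
    rw [h0, ← lintegral_zero (μ := (volume : Measure E3))]
    refine lintegral_congr_ae ?_
    filter_upwards [Lp.coeFn_zero ℂ 2 (volume : Measure E3)] with ξ hξ
    rw [hξ]
    simp
  exact ⟨0, Lp.coeFn_zero _ _ _, by rw [h1]; simp, by rw [h1]; simp⟩

/-- A symbol whose Fourier bounds hold for almost every `ω` agrees almost everywhere with a good
symbol. -/
theorem exists_goodSymbol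
    (hm : AEStronglyMeasurable (Function.uncurry b) ((volume : Measure E3).prod surfS2))
    (hbd : ∀ᵐ ω ∂surfS2, FourierBound K ω (fun x => b x ω)) :
    ∃ b' : E3 → S2 → ℂ, GoodSymbol K b' ∧ ∀ᵐ x : E3, ∀ᵐ ω ∂surfS2, b x ω = b' x ω := by
  set b0 := hm.mk
  have hb0 : Measurable b0 := hm.stronglyMeasurable_mk.measurable
  have hxω : ∀ᵐ x : E3, ∀ᵐ ω ∂surfS2, b x ω = b0 (x, ω) := Measure.ae_ae_of_ae_prod hm.ae_eq_mk
  have hωx : ∀ᵐ ω ∂surfS2, ∀ᵐ x : E3, b x ω = b0 (x, ω) := by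
    have := Measure.measurePreserving_swap (μ := surfS2) (ν := (volume : Measure E3))
    exact Measure.ae_ae_of_ae_prod (this.quasiMeasurePreserving.ae hm.ae_eq_mk)
  -- The symbol is set to `0` on a measurable null set of directions containing the bad ones.
  set N : Set S2 := {ω | ¬(FourierBound K ω (fun x => b x ω) ∧ ∀ᵐ x : E3, b x ω = b0 (x, ω))}
  have hN : surfS2 N = 0 := by
    have : ∀ᵐ ω ∂surfS2, FourierBound K ω (fun x => b x ω) ∧ ∀ᵐ x : E3, b x ω = b0 (x, ω) :=
      hbd.and hωx
    exact ae_iff.1 this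
  have hNm : MeasurableSet (toMeasurable surfS2 N) := measurableSet_toMeasurable _ _
  have hN0 : surfS2 (toMeasurable surfS2 N) = 0 := by rw [measure_toMeasurable, hN]
  classical
  refine ⟨fun x ω => if ω ∈ toMeasurable surfS2 N then 0 else b0 (x, ω), ⟨?_, ?_⟩, ?_⟩
  · exact Measurable.ite (measurable_snd hNm) measurable_const hb0
  · intro ω
    by_cases h : ω ∈ toMeasurable surfS2 N
    · simp only [h, if_true]; exact fourierBound_zero ω
    · simp only [h, if_false]
      have h2 : ω ∉ N := fun hω => h (subset_toMeasurable _ _ hω)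
      have h3 := not_not.1 h2
      exact h3.1.congr h3.2
  · filter_upwards [hxω] with x hx
    filter_upwards [hx, measure_eq_zero_iff_ae_notMem.1 hN0] with ω h1 h2
    rw [if_neg h2, h1]

theorem psdoConverges_congr {b' : E3 → S2 → ℂ} {x : E3} (h : ∀ᵐ ω ∂surfS2, b x ω = b' x ω)
    (f : L2E3) : PsdoConverges b f x ↔ PsdoConverges b' f x := by
  refine integrable_congr ?_
  have : ∀ᵐ p : S2 × ℝ ∂(surfS2.prod (volume.restrict (Ioi (0 : ℝ)))), b x p.1 = b' x p.1 :=
    Measure.quasiMeasurePreserving_fst.ae h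
  filter_upwards [this] with p hp
  simp only [psdoIntegrand, hp]

theorem psdo_congr {b' : E3 → S2 → ℂ} {x : E3} (h : ∀ᵐ ω ∂surfS2, b x ω = b' x ω)
    (f : L2E3) : psdo b f x = psdo b' f x := by
  refine integral_congr_ae ?_
  filter_upwards [h] with ω hω
  simp only [psdoIntegrand, hω]

theorem SymbolBound.ae_fourierBound {α D : ℝ} (h : SymbolBound α D b) :
    ∀ᵐ ω ∂surfS2, FourierBound (3 * ENNReal.ofReal D ^ 2) ω (fun x => b x ω) := by
  obtain ⟨W, -, hω⟩ := h
  filter_upwards [hω] with ω ⟨G, H, hG, hH, hle⟩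
  refine fourierBound_of_sobolevNorm_add_le ω hG hH (le_trans ?_ hle) (le_trans ?_ hle)
  · exact (le_self_add.trans le_self_add).trans le_self_add
  · exact le_add_self.trans le_self_add

theorem SymbolBound.aestronglyMeasurable {α D : ℝ} (h : SymbolBound α D b) :
    AEStronglyMeasurable (Function.uncurry b) ((volume : Measure E3).prod surfS2) := by
  obtain ⟨W, hW, -⟩ := h
  exact hW.1.aestronglyMeasurable

end

/-- For every `α > 0` there is a constant `C`, depending only on `α`, such that each symbol `b` with
the bound `D` defines an operator `B` on `L²(ℝ³)` with `‖Bf‖ ≤ C D ‖f‖`. For `f ∈ L²` the defining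
integral converges absolutely at almost every point as soon as the Fourier transform of `f` is
integrable (a dense subspace), and `Bf` equals the integral at almost every point where it
converges absolutely. -/
theorem theorem3 (α : ℝ) (hα : 0 < α) :
    ∃ C : ℝ, 0 < C ∧
      ∀ D : ℝ, 0 < D → ∀ b : E3 → S2 → ℂ, SymbolBound α D b →
        ∃ B : L2E3 →L[ℂ] L2E3,
          (∀ f : L2E3, Integrable (fourierAng f) volume → ∀ᵐ x : E3, PsdoConverges b f x) ∧
          (∀ f : L2E3, ∀ᵐ x : E3, PsdoConverges b f x → B f x = psdo b f x) ∧
          (∀ f : L2E3, ‖B f‖ ≤ C * D * ‖f‖) := by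
  -- The summand `1` only makes the constant positive without computing `operatorConst`.
  refine ⟨(2 * Real.pi) ^ 3 * √(3 * operatorConst.toReal) + 1, by positivity, fun D hD b hb => ?_⟩
  obtain ⟨b', hb', hbb⟩ := exists_goodSymbol hb.aestronglyMeasurable hb.ae_fourierBound
  have hK : 3 * ENNReal.ofReal D ^ 2 ≠ ⊤ :=
    ENNReal.mul_ne_top (by norm_num) (ENNReal.pow_ne_top ENNReal.ofReal_ne_top)
  obtain ⟨B, h1, h2, h3⟩ := hb'.exists_operator hK
  refine ⟨B, fun f hf => ?_, fun f => ?_, fun f => ?_⟩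
  · filter_upwards [h1 f hf, hbb] with x hx hbx
    exact (psdoConverges_congr hbx f).2 hx
  · filter_upwards [h2 f, hbb] with x hx hbx hconv
    rw [psdo_congr hbx f]
    exact hx ((psdoConverges_congr hbx f).1 hconv)
  · refine (h3 f).trans (mul_le_mul_of_nonneg_right ?_ (norm_nonneg f))
    have e : √(operatorConst * (3 * ENNReal.ofReal D ^ 2)).toReal =
        √(3 * operatorConst.toReal) * D := by
      rw [ENNReal.toReal_mul, ENNReal.toReal_mul, ENNReal.toReal_pow,
        ENNReal.toReal_ofReal hD.le, ← mul_assoc, Real.sqrt_mul (by positivity),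
        Real.sqrt_sq hD.le]
      norm_num [mul_comm]
    rw [e, add_mul, one_mul, ← mul_assoc]
    linarith
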